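/- **Setting.** Let $\mathbb H_2=\{W\in \mathrm{Mat}(2,\mathbb C) : (W-W^\dagger)/2i>0\}$ and, for $a,b\in\mathbb C^2$, $$\Theta\left[\begin{smallmatrix}a\\ b\end{smallmatrix}\right](W)=\sum_{n\in\mathbb Z[i]^2}\exp\Big(\pi i\big({}^t\overline{(n+a)}\,W(n+a)+2\,\mathrm{Re}({}^t\bar b\, n)\big)\Big).$$ Let $\Theta_1,\dots,\Theta_{10}$ be the ten functions with $\left[\begin{smallmatrix}a\\ b\end{smallmatrix}\right]=\frac{1+i}{2}\,{}^t(s_1,s_2,s_3,s_4)$ where $s_1s_2s_3s_4$ is, in this order, $1111, 1100, 1000, 1001, 0100, 0000, 0001, 0011, 0010, 0110$. They are also denoted $\Theta\left(\begin{smallmatrix}ijk\\ lmn\end{smallmatrix}\right)$, where $ijk|lmn$ is, in the same order, $$123|456,\ 124|356,\ 125|346,\ 126|345,\ 134|256,\ 135|246,\ 136|245,\ 145|236,\ 146|235,\ 156|234,$$ and the square $\Theta\left(\begin{smallmatrix}ijk\\ lmn\end{smallmatrix}\right)^2$ is extended to all orderings of the labels so as to be alternating in $i,j,k$, alternating in $l,m,n$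 and symmetric under exchange of the rows. The polynomials $P_I(z)$ for the same ten $I=ijk|lmn$ are, in the same order, $$\begin{aligned}&1-(z_1z_2+z_1z_3+z_2z_3+z_1z_2z_3)z_4-z_1z_2z_3z_4^2,\quad -z_1z_2(1+z_3)z_4,\quad -1+z_1z_3z_4,\quad -(1+z_1z_4)z_2z_3z_4,\\ &-1+z_2z_3z_4,\quad -z_1z_2(1+z_3z_4)z_4,\quad z_1(1+z_2)z_3z_4,\quad 1-z_1z_2z_4,\quad (1+z_1)z_2z_3z_4,\quad -z_1z_3z_4(1+z_2z_4).\end{aligned}$$ Put $q_1=e^{\pi i w_{11}}$, $q_2=e^{\pi i w_{22}}$, $q_3=e^{\pi i (w_{12}-iw_{21})/(1-i)}$, $q_4=e^{\pi i(w_{12}+iw_{21})/(1+i)}$ and $Q_1=q_1/q_3$, $Q_2=q_2/q_3$, $Q_3=-q_4$, $Q_4=-q_3/q_4$. We write $W\to o_1$ if $W\in\mathbb H_2$ and $Q_1,\dots,Q_4\to0$. Let $\Theta$ be the weight four theta function, that is, the holomorphic function on $\mathbb H_2$ with $$\Theta^2=\tfrac{3\cdot5^2}{2^6}\Big\{\Big(\sum_{r=1}^{10}\Theta_r^4\Big)^2-4\sum_{r=1}^{10}\Theta_r^8\Big\},\qquad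 \tfrac{2^2}{3\cdot5}\,\Theta\ \sim\ -64\,(q_3-q_4)\,\frac{q_1q_2(1-q_3q_4)}{q_3q_4}\quad(W\to o_1),$$ and put $\widetilde\Theta=\frac{2^2}{3\cdot5}\Theta$ and $T=\Theta_7^2\Theta_8^2-\Theta_{10}^2\Theta_5^2+\Theta_6^2\Theta_9^2$. Let $\tau=\left(\begin{smallmatrix}1&2&3&4&5&6\\3&2&6&1&5&4\end{smallmatrix}\right)$. The *algebraic master equation* at $W\in\mathbb H_2$, with unknowns $(z,\omega_0^2)\in\mathbb C^4\times\mathbb C$, is the overdetermined system of the ten equations $$P_I(z)\,\omega_0^2=\Theta\left(\begin{smallmatrix}\tau(i)\,\tau(j)\,\tau(k)\\ \tau(l)\,\tau(m)\,\tau(n)\end{smallmatrix}\right)^2(W)\qquad(I=ijk|lmn).$$ **Statement.** A function $\Theta$ as above exists, and for any such $\Theta$ the following hold. 1. On $\mathbb H_2$, $\;T^2-4\Theta_6^2\Theta_7^2\Theta_8^2\Theta_9^2=\frac{2^4}{3^2\cdot5^2}\Theta^2$. 2. Let $W\in\mathbb H_2$ with $\Theta_8(W)\ne0$, and let $z_1,\dots,z_4\neq0$.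 Then $(z,\omega_0^2)$ solves the master equation at $W$ if and only if $$z_1=\frac{\Theta_3^2+\Theta_9^2-\omega_0^2}{\omega_0^2-\Theta_7^2},\quad z_2=\frac{\Theta_3^2+\Theta_9^2-\omega_0^2}{\omega_0^2-\Theta_9^2},\quad z_3=\frac{(\omega_0^2-\Theta_7^2)(\omega_0^2-\Theta_9^2)}{\omega_0^2(\Theta_4^2+\Theta_9^2-\omega_0^2)},\quad z_4=\frac{\Theta_4^2+\Theta_9^2-\omega_0^2}{\Theta_3^2+\Theta_9^2-\omega_0^2}\qquad(*)$$ (all denominators being nonzero) and $\omega_0^2=\frac{1}{2\Theta_8^2}(T-\widetilde\Theta)$ or $\omega_0^2=\frac1{2\Theta_8^2}(T+\widetilde\Theta)$. 3. The solution at the boundary point $o_1$, where $z=0$, is unique and is the one with the minus sign, $$\omega_0^2=\frac{1}{2\Theta_8^2}\left\{\Theta_7^2\Theta_8^2-\Theta_{10}^2\Theta_5^2+\Theta_6^2\Theta_9^2-\widetilde\Theta\right\}.\qquad(**)$$ Precisely: for all $W$ sufficiently close to $o_1$, $\Theta_8(W)$ and all numerators and denominators in $(*)$ with $\omega_0^2$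 as in $(**)$ are nonzero, and $(*)$, $(**)$ solve the master equation; this solution satisfies $z\to0$ as $W\to o_1$; and for every $R$, for all $W$ sufficiently close to $o_1$, it is the only solution $(z,\omega_0^2)$ with $|z_1|,\dots,|z_4|<R$. -/

import Mathlib

open Filter Topology Complex
open scoped ComplexOrder

namespace K3Lambda

noncomputable section

/-- The domain `ℍ₂` of complex `2 × 2` matrices `W` with `(W - W†) / 2i` positive definite. -/
def H2 : Set (Matrix (Fin 2) (Fin 2) ℂ) :=
  {W | ((2 * I)⁻¹ • (W - W.conjTranspose)).PosDef}

/-- The theta function with characteristic `a, b` on `ℍ₂`: the sum over `n ∈ ℤ[i]²` of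
`exp (π i (ᵗ(n + a)‾ W (n + a) + 2 Re (ᵗb‾ n)))`. -/
def thetaChar (a b : Fin 2 → ℂ) (W : Matrix (Fin 2) (Fin 2) ℂ) : ℂ :=
  ∑' n : Fin 2 → GaussianInt,
    let v : Fin 2 → ℂ := fun j => GaussianInt.toComplex (n j)
    cexp (Real.pi * I *
      (star (v + a) ⬝ᵥ (W.mulVec (v + a)) + 2 * (((star b ⬝ᵥ v).re : ℝ) : ℂ)))

/-- The vectors `(s₁, s₂, s₃, s₄)` of the ten even characteristics `(1 + i) / 2 · s`,
numbered from `1` to `10`. -/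
def evenChar : ℕ → Fin 4 → ℂ
  | 1 => ![1, 1, 1, 1]
  | 2 => ![1, 1, 0, 0]
  | 3 => ![1, 0, 0, 0]
  | 4 => ![1, 0, 0, 1]
  | 5 => ![0, 1, 0, 0]
  | 6 => ![0, 0, 0, 0]
  | 7 => ![0, 0, 0, 1]
  | 8 => ![0, 0, 1, 1]
  | 9 => ![0, 0, 1, 0]
  | 10 => ![0, 1, 1, 0]
  | _ => 0

/-- The ten theta functions `Θ₁, …, Θ₁₀`; the characteristic is
`a = (1 + i) / 2 · (s₁, s₂)`, `b = (1 + i) / 2 · (s₃, s₄)`. -/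
def Theta (r : ℕ) (W : Matrix (Fin 2) (Fin 2) ℂ) : ℂ :=
  thetaChar
    (((1 + I) / 2) • ![evenChar r 0, evenChar r 1])
    (((1 + I) / 2) • ![evenChar r 2, evenChar r 3]) W

/-- The ten splittings `{{i, j, k}, {l, m, n}}` of the labels `1, …, 6` with their standard
orderings. The theta function `Θ (i j k; l m n)` of the `r`-th splitting is `Θ_r`. -/
def splitting : ℕ → Fin 2 → Fin 3 → ℕ
  | 1 => ![![1, 2, 3], ![4, 5, 6]]
  | 2 => ![![1, 2, 4], ![3, 5, 6]]
  | 3 => ![![1, 2, 5], ![3, 4, 6]]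
  | 4 => ![![1, 2, 6], ![3, 4, 5]]
  | 5 => ![![1, 3, 4], ![2, 5, 6]]
  | 6 => ![![1, 3, 5], ![2, 4, 6]]
  | 7 => ![![1, 3, 6], ![2, 4, 5]]
  | 8 => ![![1, 4, 5], ![2, 3, 6]]
  | 9 => ![![1, 4, 6], ![2, 3, 5]]
  | 10 => ![![1, 5, 6], ![2, 3, 4]]
  | _ => 0

/-- For triples of distinct labels: the sign of the permutation that carries `u` to `v` if `u`
is a rearrangement of `v`, and `0` if it is not. -/
def rowSign (u v : Fin 3 → ℕ) : ℤ :=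
  (Matrix.of fun p q => if u p = v q then (1 : ℤ) else 0).det

/-- `Θ (i j k; l m n)²` for an arbitrary ordering of the labels, with `u = (i, j, k)` and
`v = (l, m, n)`. It is alternating in `i, j, k`, alternating in `l, m, n`, invariant under the
exchange of the two rows, and equal to `Θ_r²` for the `r`-th splitting in standard order. -/
def ThetaSq (u v : Fin 3 → ℕ) (W : Matrix (Fin 2) (Fin 2) ℂ) : ℂ :=
  ∑ r ∈ Finset.Icc 1 10,
    ((rowSign u (splitting r 0) * rowSign v (splitting r 1)
      + rowSign u (splitting r 1) * rowSign v (splitting r 0) : ℤ) : ℂ) * Theta r W ^ 2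

/-- The normalised `3 × 6` matrix `(E₃ 𝐚 𝐛 𝐜)`, with columns labelled by `1, …, 6`. -/
def gaugeMatrix (a b c : Fin 3 → ℂ) (p : Fin 3) : ℕ → ℂ
  | 1 => ![1, 0, 0] p
  | 2 => ![0, 1, 0] p
  | 3 => ![0, 0, 1] p
  | 4 => ![a 2, a 0, a 1] p
  | 5 => ![b 1, b 2, b 0] p
  | 6 => ![c 0, c 1, c 2] p
  | _ => 0

/-- The semi-invariant `Y_I = [i j k] [l m n]` of the `r`-th splitting. -/
def semiInvariant (A : Fin 3 → ℕ → ℂ) (r : ℕ) : ℂ :=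
  (Matrix.of fun p q => A p (splitting r 0 q)).det
    * (Matrix.of fun p q => A p (splitting r 1 q)).det

/-- The affine coordinates `z₁, …, z₄` of the matrix `(E₃ 𝐚 𝐛 𝐜)`. -/
def zCoord (a b c : Fin 3 → ℂ) : Fin 4 → ℂ :=
  ![-(a 1 * c 1) / (a 0 * c 2), -(a 1 * b 1) / (a 2 * b 0), -(b 1 * c 1) / (b 2 * c 0),
    (a 2 * b 2 * c 2) / (a 1 * b 1 * c 1)]

/-- The polynomials `P_I (z)`, numbered as the splittings `I`; the variables `z₁, …, z₄` are
`z 0, …, z 3`. They express `Y_I / (a₀ b₀ c₀)` in the affine coordinates,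
see `semiInvariant_gaugeMatrix`. -/
def P (z : Fin 4 → ℂ) : ℕ → ℂ
  | 1 => 1 - (z 0 * z 1 + z 0 * z 2 + z 1 * z 2 + z 0 * z 1 * z 2) * z 3
      - z 0 * z 1 * z 2 * z 3 ^ 2
  | 2 => -(z 0 * z 1 * (1 + z 2) * z 3)
  | 3 => -1 + z 0 * z 2 * z 3
  | 4 => -((1 + z 0 * z 3) * z 1 * z 2 * z 3)
  | 5 => -1 + z 1 * z 2 * z 3
  | 6 => -(z 0 * z 1 * (1 + z 2 * z 3) * z 3)
  | 7 => z 0 * (1 + z 1) * z 2 * z 3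
  | 8 => 1 - z 0 * z 1 * z 3
  | 9 => (1 + z 0) * z 1 * z 2 * z 3
  | 10 => -(z 0 * z 2 * z 3 * (1 + z 1 * z 3))
  | _ => 0

theorem semiInvariant_gaugeMatrix (a b c : Fin 3 → ℂ) (ha : ∀ j, a j ≠ 0) (hb : ∀ j, b j ≠ 0)
    (hc : ∀ j, c j ≠ 0) (r : ℕ) (hr : r ∈ Finset.Icc 1 10) :
    semiInvariant (gaugeMatrix a b c) r = a 0 * b 0 * c 0 * P (zCoord a b c) r := by
  have ha0 := ha 0
  have ha1 := ha 1
  have ha2 := ha 2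
  have hb0 := hb 0
  have hb1 := hb 1
  have hb2 := hb 2
  have hc0 := hc 0
  have hc1 := hc 1
  have hc2 := hc 2
  rw [Finset.mem_Icc] at hr
  obtain ⟨h1, h2⟩ := hr
  interval_cases r <;>
  · simp [semiInvariant, splitting, Matrix.det_fin_three, gaugeMatrix, P, zCoord]
    try field_simp
    try ring

/-- The permutation `τ` of the labels `1, …, 6`. -/
def tau : ℕ → ℕ
  | 1 => 3
  | 2 => 2
  | 3 => 6
  | 4 => 1
  | 5 => 5
  | 6 => 4
  | j => j

/-- The algebraic master equation at `W` for the unknowns `z = (z₁, …, z₄)` and `w = ω₀²`: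
`P_I (z) ω₀² = Θ (τ i τ j τ k; τ l τ m τ n)²` for all ten `I = {{i, j, k}, {l, m, n}}`. -/
def MasterEquation (W : Matrix (Fin 2) (Fin 2) ℂ) (z : Fin 4 → ℂ) (w : ℂ) : Prop :=
  ∀ r ∈ Finset.Icc 1 10,
    P z r * w = ThetaSq (fun p => tau (splitting r 0 p)) (fun p => tau (splitting r 1 p)) W

/-- `T = Θ₇² Θ₈² - Θ₁₀² Θ₅² + Θ₆² Θ₉²`. -/
def T (W : Matrix (Fin 2) (Fin 2) ℂ) : ℂ :=
  Theta 7 W ^ 2 * Theta 8 W ^ 2 - Theta 10 W ^ 2 * Theta 5 W ^ 2 + Theta 6 W ^ 2 * Theta 9 W ^ 2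

/-- The rational functions that express `z₁, …, z₄` by the theta functions and `w = ω₀²`. -/
def zTheta (W : Matrix (Fin 2) (Fin 2) ℂ) (w : ℂ) : Fin 4 → ℂ :=
  ![(Theta 3 W ^ 2 + Theta 9 W ^ 2 - w) / (w - Theta 7 W ^ 2),
    (Theta 3 W ^ 2 + Theta 9 W ^ 2 - w) / (w - Theta 9 W ^ 2),
    ((w - Theta 7 W ^ 2) * (w - Theta 9 W ^ 2)) / (w * (Theta 4 W ^ 2 + Theta 9 W ^ 2 - w)),
    (Theta 4 W ^ 2 + Theta 9 W ^ 2 - w) / (Theta 3 W ^ 2 + Theta 9 W ^ 2 - w)]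

/-- The variables `q₁, …, q₄` (as `q W 0, …, q W 3`). They satisfy
`q₃ q₄ = exp (π i (w₁₂ + w₂₁))` and `q₃ / q₄ = exp (-π (w₁₂ - w₂₁))`. -/
def q (W : Matrix (Fin 2) (Fin 2) ℂ) : Fin 4 → ℂ :=
  ![cexp (Real.pi * I * W 0 0), cexp (Real.pi * I * W 1 1),
    cexp (Real.pi * I * ((W 0 1 - I * W 1 0) / (1 - I))),
    cexp (Real.pi * I * ((W 0 1 + I * W 1 0) / (1 + I)))]

theorem q_mul (W : Matrix (Fin 2) (Fin 2) ℂ) :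
    q W 2 * q W 3 = cexp (Real.pi * I * (W 0 1 + W 1 0)) ∧
      q W 2 / q W 3 = cexp (-(Real.pi * (W 0 1 - W 1 0))) := by
  have h1 : (1 - I) ≠ 0 := fun h => by simpa using congrArg Complex.re h
  have h2 : (1 + I) ≠ 0 := fun h => by simpa using congrArg Complex.re h
  have hI : I ^ 2 = -1 := I_sq
  have e1 : (W 0 1 - I * W 1 0) / (1 - I) = (W 0 1 + W 1 0 + I * (W 0 1 - W 1 0)) / 2 := by
    rw [div_eq_div_iff h1 two_ne_zero]
    linear_combination (W 0 1 - W 1 0) * hI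
  have e2 : (W 0 1 + I * W 1 0) / (1 + I) = (W 0 1 + W 1 0 - I * (W 0 1 - W 1 0)) / 2 := by
    rw [div_eq_div_iff h2 two_ne_zero]
    linear_combination (W 0 1 - W 1 0) * hI
  constructor
  · simp only [q, Matrix.cons_val]
    rw [← Complex.exp_add, e1, e2]
    congr 1
    ring
  · simp only [q, Matrix.cons_val]
    rw [← Complex.exp_sub, e1, e2]
    congr 1
    linear_combination (Real.pi * (W 0 1 - W 1 0)) * hI

/-- The coordinates `Q₁ = q₁ / q₃`, `Q₂ = q₂ / q₃`, `Q₃ = -q₄`, `Q₄ = -q₃ / q₄`; the boundary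
point `o₁` is `Q = 0`. -/
def Q (W : Matrix (Fin 2) (Fin 2) ℂ) : Fin 4 → ℂ :=
  ![q W 0 / q W 2, q W 1 / q W 2, -q W 3, -(q W 2 / q W 3)]

/-- `W ∈ ℍ₂` tends to the boundary point `o₁`, i.e. `Q (W)` tends to `0`. -/
def toBoundary : Filter (Matrix (Fin 2) (Fin 2) ℂ) :=
  comap Q (𝓝 0) ⊓ 𝓟 H2

/-- `Θt` is the weight four theta function `Θ` on `ℍ₂`: the holomorphic square root of
`(3 · 5² / 2⁶) ((∑ Θᵢ⁴)² - 4 ∑ Θᵢ⁸)`, with its sign fixed by the expansion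
`(2² / (3 · 5)) Θ = -64 (q₃ - q₄) (q₁ q₂ (1 - q₃ q₄) / (q₃ q₄) + ⋯)`.
Explicitly it is `15` times the product of the four functions `thetaChar a b` with
`a ∈ {0, (1 + i) / 2 · (1, 1)}` and `b ∈ {(1 / 2, 1 / 2), (1 / 2, i / 2)}`. -/
structure IsWeightFourTheta (Θt : Matrix (Fin 2) (Fin 2) ℂ → ℂ) : Prop where
  holomorphic : DifferentiableOn ℂ (fun x : Fin 2 → Fin 2 → ℂ => Θt (Matrix.of x))
    {x | Matrix.of x ∈ H2}
  sq_eq : ∀ W ∈ H2, Θt W ^ 2 = 3 * 5 ^ 2 / 2 ^ 6 *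
    ((∑ r ∈ Finset.Icc 1 10, Theta r W ^ 4) ^ 2 - 4 * ∑ r ∈ Finset.Icc 1 10, Theta r W ^ 8)
  expansion : Tendsto
    (fun W => 2 ^ 2 / (3 * 5) * Θt W /
      (-64 * (q W 2 - q W 3) * (q W 0 * q W 1 * (1 - q W 2 * q W 3) / (q W 2 * q W 3))))
    toBoundary (𝓝 1)

/-- `Θ̃ = (2² / (3 · 5)) Θ`. -/
def thetaTilde (Θt : Matrix (Fin 2) (Fin 2) ℂ → ℂ) (W : Matrix (Fin 2) (Fin 2) ℂ) : ℂ :=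
  2 ^ 2 / (3 * 5) * Θt W

/-- The right hand side of the formula for `ω₀²`. -/
def omegaSq (Θt : Matrix (Fin 2) (Fin 2) ℂ → ℂ) (W : Matrix (Fin 2) (Fin 2) ℂ) : ℂ :=
  (T W - thetaTilde Θt W) / (2 * Theta 8 W ^ 2)

end

end K3Lambda

namespace K3Lambda

noncomputable section

/-! ### Elimination in the master equation, assuming the linear relations between squares. -/

section LinearRelations

/-! The squares of the ten even theta functions are linear forms in only five parameters
(`linearRelations`). They are expanded by a duplication formula in products of theta constants at `2
W` (`thetaChar_half_sq`). Multiplication by `i` identifies many of these constants, and the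
vanishing of the odd theta functions gives the relations that reduce the products to five
parameters.

The rest of the algebra happens in these parameters. With M = Θ₃² + Θ₉² - w and N = Θ₄² + Θ₉² - w,
the master equation says that w - Θ₆², w - Θ₇², w - Θ₉², M and N are `w` times monomials in `z`.
Such monomials are consistent only if M N w = (w - Θ₆²)(w - Θ₇²)(w - Θ₉²). The cubic terms cancel
and Θ₈² w² - T w + Θ₆² Θ₇² Θ₉² = 0 remains (`LinearRelations.cubic_eq`). The discriminant of this
quadratic equation is a multiple of (∑ Θᵢ⁴)² - 4 ∑ Θᵢ⁸, hence of Θ². Existence of Θ comes from an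
explicit product of four theta functions, whose square is computed by the same duplication formula
(`weightFourProduct_sq`).

Near `o₁` every theta series is divided by its leading monomial in the square roots of the `Q`s, and
dominated convergence gives the limit (`tendsto_thetaSeries_div`). The contribution of Θ̃ to M and N
either doubles or cancels that of the fifth parameter. Where it cancels, the product of the values
at the two roots is a monomial in theta functions and gives the missing order. For the minus sign
the outcome is z ~ (4 Q₁, 4 Q₂, 4 Q₃, Q₄), which tends to 0; for the plus sign z₄ ~ 1 / Q₄ is
unbounded. -/

theorem thetaSq_tau_splitting (W : Matrix (Fin 2) (Fin 2) ℂ) {r : ℕ}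
    (hr : r ∈ Finset.Icc 1 10) :
    ThetaSq (fun p => tau (splitting r 0 p)) (fun p => tau (splitting r 1 p)) W =
      match r with
      | 1 => Theta 8 W ^ 2
      | 2 => Theta 1 W ^ 2
      | 3 => -Theta 9 W ^ 2
      | 4 => -Theta 10 W ^ 2
      | 5 => -Theta 7 W ^ 2
      | 6 => Theta 2 W ^ 2
      | 7 => Theta 3 W ^ 2
      | 8 => Theta 6 W ^ 2
      | 9 => Theta 5 W ^ 2
      | 10 => -Theta 4 W ^ 2
      | _ => 0 := by
  -- `τ` carries the splitting `r` to the splitting `r'` up to reordering; the two lists record the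
  -- pairs with sign `+1` and `-1`. With the determinants written out this is a finite check.
  have key : ∀ r' ∈ Finset.Icc 1 10, ∀ r ∈ Finset.Icc 1 10,
    (rowSign (fun p => tau (splitting r 0 p)) (splitting r' 0) *
      rowSign (fun p => tau (splitting r 1 p)) (splitting r' 1) +
      rowSign (fun p => tau (splitting r 0 p)) (splitting r' 1) *
      rowSign (fun p => tau (splitting r 1 p)) (splitting r' 0)) = 
      if (r, r') ∈ [(1, 8), (2, 1), (6, 2), (7, 3), (8, 6), (9, 5)] then 1 else
      if (r, r') ∈ [(3, 9), (4, 10), (5, 7), (10, 4)] then -1 else 0 := by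
    intro r' hr' r hr
    simp only [rowSign, Matrix.det_fin_three, Matrix.of_apply]
    revert r
    revert r'
    decide
  rw [ThetaSq, Finset.sum_congr rfl fun r' hr' => by rw [key r' hr' r hr]]
  rw [Finset.mem_Icc] at hr
  obtain ⟨h1, h2⟩ := hr
  interval_cases r <;> simp

theorem masterEquation_iff_forall (W : Matrix (Fin 2) (Fin 2) ℂ) (z : Fin 4 → ℂ) (w : ℂ) :
    MasterEquation W z w ↔
      P z 1 * w = Theta 8 W ^ 2 ∧ P z 2 * w = Theta 1 W ^ 2 ∧ P z 3 * w = -Theta 9 W ^ 2 ∧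
      P z 4 * w = -Theta 10 W ^ 2 ∧ P z 5 * w = -Theta 7 W ^ 2 ∧ P z 6 * w = Theta 2 W ^ 2 ∧
      P z 7 * w = Theta 3 W ^ 2 ∧ P z 8 * w = Theta 6 W ^ 2 ∧ P z 9 * w = Theta 5 W ^ 2 ∧
      P z 10 * w = -Theta 4 W ^ 2 := by
  rw [MasterEquation, forall₂_congr fun r hr => by rw [thetaSq_tau_splitting W hr]]
  constructor
  · intro h
    exact ⟨h 1 (by decide), h 2 (by decide), h 3 (by decide), h 4 (by decide), h 5 (by decide),
      h 6 (by decide), h 7 (by decide), h 8 (by decide), h 9 (by decide), h 10 (by decide)⟩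
  · rintro ⟨h1, h2, h3, h4, h5, h6, h7, h8, h9, h10⟩ r hr
    rw [Finset.mem_Icc] at hr
    obtain ⟨hr1, hr2⟩ := hr
    interval_cases r <;> assumption

/-- The linear relations between the squares of the ten theta functions, solved by means of five
parameters. -/
structure LinearRelations (W : Matrix (Fin 2) (Fin 2) ℂ) (a b c d D : ℂ) : Prop where
  eq6 : Theta 6 W ^ 2 = a + b + c + d
  eq7 : Theta 7 W ^ 2 = a - b + c - d
  eq8 : Theta 8 W ^ 2 = a - b - c + d
  eq9 : Theta 9 W ^ 2 = a + b - c - d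
  eq3 : Theta 3 W ^ 2 = 2 * (c + D)
  eq4 : Theta 4 W ^ 2 = 2 * (c - D)
  eq5 : Theta 5 W ^ 2 = 2 * (b + D)
  eq10 : Theta 10 W ^ 2 = 2 * (b - D)
  eq2 : Theta 2 W ^ 2 = 2 * (d + D)
  eq1 : Theta 1 W ^ 2 = 2 * (d - D)

variable {W : Matrix (Fin 2) (Fin 2) ℂ} {a b c d D : ℂ}

theorem LinearRelations.T_eq (h : LinearRelations W a b c d D) :
    T W = 2 * (a ^ 2 - b ^ 2 - c ^ 2 - d ^ 2 + 2 * D ^ 2) := by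
  rw [T, h.eq7, h.eq8, h.eq10, h.eq5, h.eq6, h.eq9]
  ring

/-- Both sides are polynomials in the five parameters, so no analysis enters. -/
theorem LinearRelations.discriminant_eq (h : LinearRelations W a b c d D) :
    T W ^ 2 - 4 * Theta 6 W ^ 2 * Theta 7 W ^ 2 * Theta 8 W ^ 2 * Theta 9 W ^ 2 =
      1 / 12 * ((∑ r ∈ Finset.Icc 1 10, Theta r W ^ 4) ^ 2
        - 4 * ∑ r ∈ Finset.Icc 1 10, Theta r W ^ 8) := by
  have e4 : ∀ r, Theta r W ^ 4 = (Theta r W ^ 2) ^ 2 := fun r => by ring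
  have e8 : ∀ r, Theta r W ^ 8 = (Theta r W ^ 2) ^ 4 := fun r => by ring
  simp only [e4, e8]
  rw [h.T_eq]
  simp only [Nat.reduceLeDiff, Finset.sum_Icc_succ_top, Finset.Icc_self, Finset.sum_singleton,
    Nat.reduceAdd, h.eq1, h.eq2, h.eq3, h.eq4, h.eq5, h.eq6, h.eq7, h.eq8, h.eq9, h.eq10]
  ring

/-- The compatibility condition for `w` is only quadratic: the cubes cancel, and the linear
relations turn the other coefficients into `Θ₈²` and `T`. -/
theorem LinearRelations.cubic_eq (h : LinearRelations W a b c d D) (w : ℂ) :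
    (Theta 3 W ^ 2 + Theta 9 W ^ 2 - w) * (Theta 4 W ^ 2 + Theta 9 W ^ 2 - w) * w
      - (w - Theta 6 W ^ 2) * (w - Theta 7 W ^ 2) * (w - Theta 9 W ^ 2) =
    Theta 8 W ^ 2 * w ^ 2 - T W * w + Theta 6 W ^ 2 * Theta 7 W ^ 2 * Theta 9 W ^ 2 := by
  rw [h.T_eq, h.eq3, h.eq9, h.eq4, h.eq6, h.eq7, h.eq8]
  ring

/-- Sums of the equations make the five factors of `zTheta` and of the cubic monomials in `z` times
`w`. Quotients of these monomials recover `z`, and both products in `cubic_eq` equal z₁² z₂² z₃² z₄³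
w³. Conversely five equations follow from the monomial formulas alone, the others also need the
linear relations `r1`, …, `r5`. -/
theorem LinearRelations.masterEquation_iff (h : LinearRelations W a b c d D)
    (h8 : Theta 8 W ≠ 0) {z : Fin 4 → ℂ} (hz : ∀ k, z k ≠ 0) (w : ℂ) :
    MasterEquation W z w ↔ z = zTheta W w ∧
      Theta 8 W ^ 2 * w ^ 2 - T W * w + Theta 6 W ^ 2 * Theta 7 W ^ 2 * Theta 9 W ^ 2 = 0 := by
  have hcub := h.cubic_eq w
  have r1 : Theta 8 W ^ 2 = Theta 6 W ^ 2 + Theta 7 W ^ 2 - Theta 9 W ^ 2 - Theta 3 W ^ 2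
      - Theta 4 W ^ 2 := by
    rw [h.eq8, h.eq6, h.eq7, h.eq9, h.eq3, h.eq4]; ring
  have r2 : Theta 5 W ^ 2 = Theta 3 W ^ 2 + Theta 9 W ^ 2 - Theta 7 W ^ 2 := by
    rw [h.eq5, h.eq7, h.eq9, h.eq3]; ring
  have r3 : Theta 10 W ^ 2 = Theta 4 W ^ 2 + Theta 9 W ^ 2 - Theta 7 W ^ 2 := by
    rw [h.eq10, h.eq7, h.eq9, h.eq4]; ring
  have r4 : Theta 1 W ^ 2 = Theta 6 W ^ 2 - Theta 3 W ^ 2 - Theta 9 W ^ 2 := by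
    rw [h.eq1, h.eq6, h.eq9, h.eq3]; ring
  have r5 : Theta 2 W ^ 2 = Theta 6 W ^ 2 - Theta 4 W ^ 2 - Theta 9 W ^ 2 := by
    rw [h.eq2, h.eq6, h.eq9, h.eq4]; ring
  rw [masterEquation_iff_forall, ← hcub]
  have h8' : Theta 8 W ^ 2 ≠ 0 := pow_ne_zero 2 h8
  have z0 := hz 0
  have z1 := hz 1
  have z2 := hz 2
  have z3 := hz 3
  constructor
  · rintro ⟨h1, h2, h3, h4, h5, h6, h7, h8, h9, h10⟩
    simp only [P] at h1 h2 h3 h4 h5 h6 h7 h8 h9 h10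
    have hw : w ≠ 0 := by
      rintro rfl
      exact h8' (by rw [← h1, mul_zero])
    have e9 : w - Theta 9 W ^ 2 = z 0 * z 2 * z 3 * w := by linear_combination -h3
    have e7 : w - Theta 7 W ^ 2 = z 1 * z 2 * z 3 * w := by linear_combination -h5
    have e6 : w - Theta 6 W ^ 2 = z 0 * z 1 * z 3 * w := by linear_combination h8
    have eM : Theta 3 W ^ 2 + Theta 9 W ^ 2 - w = z 0 * z 1 * z 2 * z 3 * w := by
      linear_combination -h7 + h3
    have eN : Theta 4 W ^ 2 + Theta 9 W ^ 2 - w = z 0 * z 1 * z 2 * z 3 ^ 2 * w := by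
      linear_combination h10 + h3
    constructor
    · funext k
      fin_cases k
      · simp [zTheta, eM, e7]; field_simp
      · simp [zTheta, eM, e9]; field_simp
      · simp [zTheta, e9, e7, eN]; field_simp
      · simp [zTheta, eM, eN]; field_simp
    · rw [eM, eN, e6, e7, e9]; ring
  -- Division by zero has value `0`, so `z k ≠ 0` already forces numerators and denominators in
  -- `zTheta` to be nonzero.
  · rintro ⟨hzw, hq⟩
    have k0 : z 0 = (Theta 3 W ^ 2 + Theta 9 W ^ 2 - w) / (w - Theta 7 W ^ 2) := by
      rw [hzw]; rfl
    have k1 : z 1 = (Theta 3 W ^ 2 + Theta 9 W ^ 2 - w) / (w - Theta 9 W ^ 2) := by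
      rw [hzw]; rfl
    have k2 : z 2 = ((w - Theta 7 W ^ 2) * (w - Theta 9 W ^ 2)) /
        (w * (Theta 4 W ^ 2 + Theta 9 W ^ 2 - w)) := by
      rw [hzw]; rfl
    have k3 : z 3 = (Theta 4 W ^ 2 + Theta 9 W ^ 2 - w) / (Theta 3 W ^ 2 + Theta 9 W ^ 2 - w) := by
      rw [hzw]; rfl
    rw [k0] at z0
    rw [k1] at z1
    rw [k2] at z2
    obtain ⟨hM, n7⟩ := div_ne_zero_iff.1 z0
    have n9 := (div_ne_zero_iff.1 z1).2
    have hw := left_ne_zero_of_mul (div_ne_zero_iff.1 z2).2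
    have hN := right_ne_zero_of_mul (div_ne_zero_iff.1 z2).2
    have e9 : z 0 * z 2 * z 3 * w = w - Theta 9 W ^ 2 := by
      rw [k0, k2, k3]; field_simp
    have e7 : z 1 * z 2 * z 3 * w = w - Theta 7 W ^ 2 := by
      rw [k1, k2, k3]; field_simp
    -- Among the monomial formulas, only this one needs the equation for `w`.
    have e6 : z 0 * z 1 * z 3 * w = w - Theta 6 W ^ 2 := by
      rw [k0, k1, k3]; field_simp
      linear_combination hq
    have eM : z 0 * z 1 * z 2 * z 3 * w = Theta 3 W ^ 2 + Theta 9 W ^ 2 - w := by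
      rw [k0, k1, k2, k3]; field_simp
    have eN : z 0 * z 1 * z 2 * z 3 ^ 2 * w = Theta 4 W ^ 2 + Theta 9 W ^ 2 - w := by
      rw [k0, k1, k2, k3]; field_simp
    simp only [P]
    refine ⟨?_, ?_, ?_, ?_, ?_, ?_, ?_, ?_, ?_, ?_⟩
    · linear_combination -r1 - e6 - e9 - e7 - eM - eN
    · linear_combination -r4 - e6 - eM
    · linear_combination e9
    · linear_combination r3 - e7 - eN
    · linear_combination e7
    · linear_combination -r5 - e6 - eN
    · linear_combination e9 + eM
    · linear_combination -e6
    · linear_combination e7 + eM - r2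
    · linear_combination -e9 - eN

end LinearRelations

/-! ### Positivity of the form and convergence of the theta series. -/

/-- The vector of complex numbers underlying a vector of Gaussian integers. -/
def gaussVec (n : Fin 2 → GaussianInt) : Fin 2 → ℂ := fun j => GaussianInt.toComplex (n j)

/-- The value `x† W x`. -/
def sesqForm (W : Matrix (Fin 2) (Fin 2) ℂ) (x : Fin 2 → ℂ) : ℂ := star x ⬝ᵥ W.mulVec x

/-- The squared Euclidean length of a vector in `ℂ²`. -/
def lengthSq (x : Fin 2 → ℂ) : ℝ := ‖x 0‖ ^ 2 + ‖x 1‖ ^ 2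

/-- The sum of `ε n * exp (π i x† W x)` over `x = n + v` with `n ∈ ℤ[i]²`. -/
def thetaSeries (ε : (Fin 2 → GaussianInt) → ℂ) (v : Fin 2 → ℂ)
    (W : Matrix (Fin 2) (Fin 2) ℂ) : ℂ :=
  ∑' n, ε n * cexp (Real.pi * I * sesqForm W (gaussVec n + v))

/-- The character `n ↦ exp (2 π i Re (b† n))`. -/
def latticeChar (b : Fin 2 → ℂ) (n : Fin 2 → GaussianInt) : ℂ :=
  cexp (Real.pi * I * (2 * (((star b ⬝ᵥ gaussVec n).re : ℝ) : ℂ)))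

theorem thetaChar_eq_thetaSeries (a b : Fin 2 → ℂ) (W : Matrix (Fin 2) (Fin 2) ℂ) :
    thetaChar a b W = thetaSeries (latticeChar b) a W := by
  refine tsum_congr fun n => ?_
  rw [latticeChar, ← Complex.exp_add, ← mul_add, add_comm]
  rfl

theorem norm_latticeChar (b : Fin 2 → ℂ) (n : Fin 2 → GaussianInt) : ‖latticeChar b n‖ = 1 := by
  rw [latticeChar, Complex.norm_exp]
  simp

theorem sesqForm_apply (W : Matrix (Fin 2) (Fin 2) ℂ) (x : Fin 2 → ℂ) :
    sesqForm W x = star (x 0) * x 0 * W 0 0 + star (x 1) * x 1 * W 1 1 + star (x 0) * x 1 * W 0 1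
      + star (x 1) * x 0 * W 1 0 := by
  simp [sesqForm, dotProduct, Matrix.mulVec, Fin.sum_univ_two]
  ring

theorem lengthSq_nonneg (x : Fin 2 → ℂ) : 0 ≤ lengthSq x := by
  unfold lengthSq; positivity

theorem norm_sesqForm_le {W : Matrix (Fin 2) (Fin 2) ℂ} {r : ℝ} (h : ∀ i j, ‖W i j‖ ≤ r)
    (x : Fin 2 → ℂ) : ‖sesqForm W x‖ ≤ 2 * r * lengthSq x := by
  have hr : 0 ≤ r := (norm_nonneg _).trans (h 0 0)
  rw [sesqForm_apply, lengthSq]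
  have e : ∀ i j, ‖star (x i) * x j * W i j‖ ≤ ‖x i‖ * ‖x j‖ * r := fun i j => by
    rw [norm_mul, norm_mul, norm_star]
    exact mul_le_mul_of_nonneg_left (h i j) (by positivity)
  calc _ ≤ ‖star (x 0) * x 0 * W 0 0‖ + ‖star (x 1) * x 1 * W 1 1‖ + ‖star (x 0) * x 1 * W 0 1‖
      + ‖star (x 1) * x 0 * W 1 0‖ := norm_add₄_le
    _ ≤ ‖x 0‖ * ‖x 0‖ * r + ‖x 1‖ * ‖x 1‖ * r + ‖x 0‖ * ‖x 1‖ * r + ‖x 1‖ * ‖x 0‖ * r := by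
      gcongr <;> exact e _ _
    _ ≤ _ := by nlinarith [mul_nonneg hr (sq_nonneg (‖x 0‖ - ‖x 1‖))]

theorem im_sesqForm_pos {W : Matrix (Fin 2) (Fin 2) ℂ} (hW : W ∈ H2) {x : Fin 2 → ℂ}
    (hx : x ≠ 0) : 0 < (sesqForm W x).im := by
  have h := hW.dotProduct_mulVec_pos hx
  have e : star x ⬝ᵥ (((2 * I)⁻¹ • (W - W.conjTranspose)).mulVec x) =
      (((sesqForm W x).im : ℝ) : ℂ) := by
    have h1 : star x ⬝ᵥ (W.conjTranspose.mulVec x) = star (sesqForm W x) := by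
      rw [sesqForm, ← Matrix.star_dotProduct_star, star_star, Matrix.star_mulVec,
        ← Matrix.dotProduct_mulVec, dotProduct_comm]
    rw [Matrix.smul_mulVec, dotProduct_smul, Matrix.sub_mulVec, dotProduct_sub, h1, smul_eq_mul,
      Complex.im_eq_sub_conj, sesqForm]
    field_simp
    rfl
  rw [e] at h
  exact_mod_cast h

theorem continuous_sesqForm (W : Matrix (Fin 2) (Fin 2) ℂ) : Continuous (sesqForm W) := by
  rw [show sesqForm W = _ from funext (sesqForm_apply W)]
  fun_prop

theorem sesqForm_smul (W : Matrix (Fin 2) (Fin 2) ℂ) (u : ℂ) (x : Fin 2 → ℂ) :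
    sesqForm W (u • x) = star u * u * sesqForm W x := by
  simp [sesqForm_apply]; ring

theorem lengthSq_smul (u : ℂ) (x : Fin 2 → ℂ) : lengthSq (u • x) = ‖u‖ ^ 2 * lengthSq x := by
  simp [lengthSq]; ring

/-- `δ` is the minimum of the imaginary part on the compact unit sphere; homogeneity extends the
bound to all vectors. -/
theorem exists_mul_lengthSq_le {W : Matrix (Fin 2) (Fin 2) ℂ} (hW : W ∈ H2) :
    ∃ δ > 0, ∀ x, δ * lengthSq x ≤ (sesqForm W x).im := by
  have hc : IsCompact {x : Fin 2 → ℂ | lengthSq x = 1} := by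
    refine Metric.isCompact_of_isClosed_isBounded
      (isClosed_eq (by unfold lengthSq; fun_prop) continuous_const) ?_
    refine (Metric.isBounded_iff_subset_closedBall 0).2 ⟨1, fun x hx => ?_⟩
    rw [mem_closedBall_zero_iff, pi_norm_le_iff_of_nonneg zero_le_one, Fin.forall_fin_two]
    change lengthSq x = 1 at hx
    rw [lengthSq] at hx
    constructor <;> nlinarith [norm_nonneg (x 0), norm_nonneg (x 1)]
  have hne : {x : Fin 2 → ℂ | lengthSq x = 1}.Nonempty := ⟨![1, 0], by simp [lengthSq]⟩
  obtain ⟨y, hy, hmin⟩ := hc.exists_isMinOn hne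
    (Complex.continuous_im.comp (continuous_sesqForm W)).continuousOn
  have hy0 : y ≠ 0 := by rintro rfl; simp [lengthSq] at hy
  refine ⟨(sesqForm W y).im, im_sesqForm_pos hW hy0, fun x => ?_⟩
  by_cases hx : x = 0
  · subst hx; simp [lengthSq, sesqForm]
  have hl : 0 < lengthSq x := by
    refine lt_of_le_of_ne (lengthSq_nonneg x) fun h => hx ?_
    rw [lengthSq] at h
    funext j
    have h0 : ‖x 0‖ = 0 := by nlinarith [sq_nonneg ‖x 0‖, sq_nonneg ‖x 1‖]
    have h1 : ‖x 1‖ = 0 := by nlinarith [sq_nonneg ‖x 0‖, sq_nonneg ‖x 1‖]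
    fin_cases j
    · exact norm_eq_zero.1 h0
    · exact norm_eq_zero.1 h1
  set s : ℝ := Real.sqrt (lengthSq x) with hs
  have hs2 : s ^ 2 = lengthSq x := Real.sq_sqrt hl.le
  have hs0 : 0 < s := Real.sqrt_pos.2 hl
  have hxu : x = (s : ℂ) • ((s⁻¹ : ℝ) : ℂ) • x := by
    rw [smul_smul, ← Complex.ofReal_mul, mul_inv_cancel₀ hs0.ne', Complex.ofReal_one, one_smul]
  have hu : lengthSq (((s⁻¹ : ℝ) : ℂ) • x) = 1 := by
    rw [lengthSq_smul, ← hs2, Complex.norm_real, norm_inv, Real.norm_of_nonneg hs0.le]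
    field_simp
  have h1 : (sesqForm W y).im ≤ (sesqForm W (((s⁻¹ : ℝ) : ℂ) • x)).im := hmin hu
  have h2 : (sesqForm W x).im = s ^ 2 * (sesqForm W (((s⁻¹ : ℝ) : ℂ) • x)).im := by
    conv_lhs => rw [hxu, sesqForm_smul]
    rw [star_def, conj_ofReal, ← ofReal_mul, im_ofReal_mul, sq]
  rw [h2, mul_comm, ← hs2]
  gcongr

theorem eventually_mul_lengthSq_le {W : Matrix (Fin 2) (Fin 2) ℂ} (hW : W ∈ H2) :
    ∃ δ > 0, ∃ r > 0, ∀ W' : Matrix (Fin 2) (Fin 2) ℂ, (∀ i j, ‖W' i j - W i j‖ ≤ r) →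
      ∀ x, δ * lengthSq x ≤ (sesqForm W' x).im := by
  obtain ⟨δ, hδ, h⟩ := exists_mul_lengthSq_le hW
  -- A perturbation by `δ / 4` in each entry changes the form by at most `2 * (δ / 4) * lengthSq x`,
  -- which leaves half of `δ`.
  refine ⟨δ / 2, half_pos hδ, δ / 4, by positivity, fun W' hW' x => ?_⟩
  have h1 : ‖sesqForm (W' - W) x‖ ≤ 2 * (δ / 4) * lengthSq x :=
    norm_sesqForm_le (W := W' - W) hW' x
  have h2 : sesqForm W' x = sesqForm W x + sesqForm (W' - W) x := by
    simp [sesqForm_apply]; ring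
  have h3 := (abs_le.1 (Complex.abs_im_le_norm (sesqForm (W' - W) x))).1
  rw [h2, Complex.add_im]
  linarith [h x]

theorem summable_exp_neg_mul_abs {c : ℝ} (hc : 0 < c) :
    Summable fun k : ℤ => Real.exp (-c * |(k : ℝ)|) := by
  have h : Summable fun k : ℕ => Real.exp (-c * k) := by
    refine (summable_geometric_of_lt_one (Real.exp_pos (-c)).le
      (Real.exp_lt_one_iff.2 (neg_neg_of_pos hc))).congr fun k => ?_
    rw [← Real.exp_nat_mul, mul_comm]
  refine Summable.of_nat_of_neg ?_ ?_ <;> simpa using h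

theorem summable_exp_neg_mul_normSq {c : ℝ} (hc : 0 < c) :
    Summable fun z : GaussianInt => Real.exp (-c * ‖GaussianInt.toComplex z‖ ^ 2) := by
  have h := (summable_exp_neg_mul_abs hc).mul_of_nonneg (summable_exp_neg_mul_abs hc)
    (fun _ => (Real.exp_pos _).le) (fun _ => (Real.exp_pos _).le)
  have hi : Function.Injective fun z : GaussianInt => (z.re, z.im) := fun z w hzw =>
    Zsqrtd.ext (Prod.ext_iff.1 hzw).1 (Prod.ext_iff.1 hzw).2
  refine Summable.of_nonneg_of_le (fun _ => (Real.exp_pos _).le) (fun z => ?_)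
    (h.comp_injective hi)
  simp only [Function.comp_apply, ← Real.exp_add]
  refine Real.exp_le_exp.2 ?_
  have hk : ∀ k : ℤ, |(k : ℝ)| ≤ (k : ℝ) ^ 2 := fun k => by
    exact_mod_cast (by rw [← sq_abs]; exact Int.le_self_sq |k| : |k| ≤ k ^ 2)
  rw [← Complex.normSq_eq_norm_sq, Complex.normSq_apply, ← GaussianInt.intCast_re,
    ← GaussianInt.intCast_im]
  nlinarith [hk z.re, hk z.im]

theorem summable_exp_neg_mul_lengthSq {c : ℝ} (hc : 0 < c) (v : Fin 2 → ℂ) :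
    Summable fun n => Real.exp (-c * lengthSq (gaussVec n + v)) := by
  have h := (summable_exp_neg_mul_normSq (half_pos hc)).mul_of_nonneg
    (summable_exp_neg_mul_normSq (half_pos hc))
    (fun _ => (Real.exp_pos _).le) (fun _ => (Real.exp_pos _).le)
  have h' := (h.comp_injective (finTwoArrowEquiv GaussianInt).injective).mul_left
    (Real.exp (c * lengthSq v))
  refine Summable.of_nonneg_of_le (fun _ => (Real.exp_pos _).le) (fun n => ?_) h'
  simp only [Function.comp_apply, ← Real.exp_add]
  refine Real.exp_le_exp.2 ?_
  have key : ∀ z w : ℂ, ‖z‖ ^ 2 / 2 ≤ ‖z + w‖ ^ 2 + ‖w‖ ^ 2 := fun z w => by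
    have h1 : ‖z‖ ≤ ‖z + w‖ + ‖w‖ := by simpa using norm_sub_le (z + w) w
    nlinarith [sq_nonneg (‖z + w‖ - ‖w‖), norm_nonneg z]
  have k0 := key (gaussVec n 0) (v 0)
  have k1 := key (gaussVec n 1) (v 1)
  change _ ≤ c * lengthSq v + (-(c / 2) * ‖gaussVec n 0‖ ^ 2 + -(c / 2) * ‖gaussVec n 1‖ ^ 2)
  simp only [lengthSq, Pi.add_apply]
  nlinarith

theorem norm_exp_sesqForm (W : Matrix (Fin 2) (Fin 2) ℂ) (x : Fin 2 → ℂ) :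
    ‖cexp (Real.pi * I * sesqForm W x)‖ = Real.exp (-Real.pi * (sesqForm W x).im) := by
  rw [Complex.norm_exp]
  congr 1
  simp [Complex.mul_re]

theorem summable_norm_thetaSeries {ε : (Fin 2 → GaussianInt) → ℂ} (hε : ∀ n, ‖ε n‖ ≤ 1)
    (v : Fin 2 → ℂ) {W : Matrix (Fin 2) (Fin 2) ℂ} (hW : W ∈ H2) :
    Summable fun n => ‖ε n * cexp (Real.pi * I * sesqForm W (gaussVec n + v))‖ := by
  obtain ⟨δ, hδ, h⟩ := exists_mul_lengthSq_le hW
  refine Summable.of_nonneg_of_le (fun _ => norm_nonneg _) (fun n => ?_)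
    (summable_exp_neg_mul_lengthSq (mul_pos Real.pi_pos hδ) v)
  rw [norm_mul, norm_exp_sesqForm]
  refine (mul_le_of_le_one_left (Real.exp_pos _).le (hε n)).trans (Real.exp_le_exp.2 ?_)
  have := mul_le_mul_of_nonneg_left (h (gaussVec n + v)) Real.pi_pos.le
  linarith

/-! ### The duplication formula for squares of theta functions. -/

theorem gaussVec_add (m n : Fin 2 → GaussianInt) : gaussVec (m + n) = gaussVec m + gaussVec n := by
  funext j; simp [gaussVec]

theorem gaussVec_sub (m n : Fin 2 → GaussianInt) : gaussVec (m - n) = gaussVec m - gaussVec n := by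
  funext j; simp [gaussVec]

theorem latticeChar_add (b : Fin 2 → ℂ) (m n : Fin 2 → GaussianInt) :
    latticeChar b (m + n) = latticeChar b m * latticeChar b n := by
  rw [latticeChar, latticeChar, latticeChar, ← Complex.exp_add, gaussVec_add, dotProduct_add,
    Complex.add_re, ofReal_add]
  congr 1
  ring

theorem latticeChar_half (β n : Fin 2 → GaussianInt) :
    latticeChar ((1 / 2 : ℂ) • gaussVec β) n = (-1) ^ ((β 0).re * (n 0).re + (β 0).im * (n 0).im
      + (β 1).re * (n 1).re + (β 1).im * (n 1).im) := by
  rw [latticeChar, ← Complex.exp_pi_mul_I, ← Complex.exp_int_mul]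
  congr 1
  have : (star ((1 / 2 : ℂ) • gaussVec β) ⬝ᵥ gaussVec n).re = (((β 0).re * (n 0).re
      + (β 0).im * (n 0).im + (β 1).re * (n 1).re + (β 1).im * (n 1).im : ℤ) : ℝ) / 2 := by
    simp [dotProduct, Fin.sum_univ_two, gaussVec]
    ring
  rw [this]
  push_cast
  ring

theorem sesqForm_add_add_sesqForm_sub (W : Matrix (Fin 2) (Fin 2) ℂ) (x y : Fin 2 → ℂ) :
    sesqForm W (x + y) + sesqForm W (x - y) = 2 * sesqForm W x + 2 * sesqForm W y := by
  simp [sesqForm_apply]; ring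

theorem sesqForm_smul_left (W : Matrix (Fin 2) (Fin 2) ℂ) (u : ℂ) (x : Fin 2 → ℂ) :
    sesqForm (u • W) x = u * sesqForm W x := by
  simp [sesqForm_apply]; ring

theorem two_smul_mem_H2 {W : Matrix (Fin 2) (Fin 2) ℂ} (hW : W ∈ H2) : (2 : ℂ) • W ∈ H2 := by
  have h : ((2 * I)⁻¹ • ((2 : ℂ) • W - ((2 : ℂ) • W).conjTranspose)) =
      (2 : ℂ) • ((2 * I)⁻¹ • (W - W.conjTranspose)) := by
    rw [Matrix.conjTranspose_smul, show star (2 : ℂ) = 2 by simp, ← smul_sub, smul_comm]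
  have h2 : (0 : ℂ) < 2 := by norm_num
  change Matrix.PosDef _
  rw [h]
  exact Matrix.PosDef.smul hW h2

/-- The multiplication by `i` on `ℤ[i]²`. -/
def mulIEquiv : (Fin 2 → GaussianInt) ≃ (Fin 2 → GaussianInt) where
  toFun n j := ⟨-(n j).im, (n j).re⟩
  invFun n j := ⟨(n j).im, -(n j).re⟩
  left_inv n := by funext j; ext <;> simp
  right_inv n := by funext j; ext <;> simp

theorem gaussVec_mulIEquiv (n : Fin 2 → GaussianInt) :
    gaussVec (mulIEquiv n) = I • gaussVec n := by
  funext j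
  simp [gaussVec, mulIEquiv, GaussianInt.toComplex_def]
  linear_combination (-((n j).im : ℂ)) * I_sq

theorem sesqForm_I_smul (W : Matrix (Fin 2) (Fin 2) ℂ) (x : Fin 2 → ℂ) :
    sesqForm W (I • x) = sesqForm W x := by
  simp [sesqForm_smul]

/-- The theta series without characters at `2 W`, with characteristic `m / 2`. -/
def thetaHalf (W : Matrix (Fin 2) (Fin 2) ℂ) (m : Fin 2 → GaussianInt) : ℂ :=
  thetaSeries (fun _ => 1) ((1 / 2 : ℂ) • gaussVec m) ((2 : ℂ) • W)

theorem thetaHalf_add_two (W : Matrix (Fin 2) (Fin 2) ℂ) (m n : Fin 2 → GaussianInt) :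
    thetaHalf W (m + (n + n)) = thetaHalf W m := by
  refine Eq.trans (tsum_congr fun k => ?_) ((Equiv.addRight n).tsum_eq fun k =>
    1 * cexp (Real.pi * I * sesqForm ((2 : ℂ) • W) (gaussVec k + (1 / 2 : ℂ) • gaussVec m)))
  rw [Equiv.coe_addRight, gaussVec_add, gaussVec_add, gaussVec_add]
  congr 4
  module

theorem thetaHalf_mulIEquiv (W : Matrix (Fin 2) (Fin 2) ℂ) (m : Fin 2 → GaussianInt) :
    thetaHalf W (mulIEquiv m) = thetaHalf W m := by
  rw [thetaHalf, thetaHalf, thetaSeries, thetaSeries, ← mulIEquiv.tsum_eq]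
  refine tsum_congr fun k => ?_
  rw [gaussVec_mulIEquiv, gaussVec_mulIEquiv, smul_comm, ← smul_add, sesqForm_I_smul]

/-- A set of representatives of `(ℤ[i] / 2)²`. -/
def residueRep (c : Fin 2 → ZMod 2 × ZMod 2) : Fin 2 → GaussianInt :=
  fun j => ⟨((c j).1.val : ℤ), ((c j).2.val : ℤ)⟩

/-- The reduction modulo `2`. -/
def residue (m : Fin 2 → GaussianInt) : Fin 2 → ZMod 2 × ZMod 2 :=
  fun j => (((m j).re : ZMod 2), ((m j).im : ZMod 2))

theorem residue_residueRep (c : Fin 2 → ZMod 2 × ZMod 2) : residue (residueRep c) = c := by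
  funext j; simp [residue, residueRep]

theorem residue_add (m n : Fin 2 → GaussianInt) : residue (m + n) = residue m + residue n := by
  funext j; simp [residue]

theorem exists_eq_residueRep_add (m : Fin 2 → GaussianInt) :
    ∃ n, m = residueRep (residue m) + (n + n) := by
  have h : ∀ k : ℤ, ∃ l : ℤ, k = (((k : ZMod 2)).val : ℤ) + (l + l) := fun k => by
    refine ⟨k / 2, ?_⟩
    rw [ZMod.val_intCast]
    push_cast
    omega
  choose f hf using h
  refine ⟨fun j => ⟨f (m j).re, f (m j).im⟩, funext fun j => ?_⟩
  ext
  · exact hf _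
  · exact hf _

theorem residue_add_self (n : Fin 2 → GaussianInt) : residue (n + n) = 0 := by
  rw [residue_add]
  exact CharTwo.add_self_eq_zero _

theorem thetaHalf_residueRep (W : Matrix (Fin 2) (Fin 2) ℂ) (m : Fin 2 → GaussianInt) :
    thetaHalf W (residueRep (residue m)) = thetaHalf W m := by
  obtain ⟨n, hn⟩ := exists_eq_residueRep_add m
  conv_rhs => rw [hn, thetaHalf_add_two]

/-- For a pair `(n, m)` the class `c` is the residue of `n + m` modulo 2. Then n + m = 2 k + c
determines `k`, and `l = k - m`. -/
theorem halving_bijective : Function.Bijective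
    (fun p : (Fin 2 → ZMod 2 × ZMod 2) × ((Fin 2 → GaussianInt) × (Fin 2 → GaussianInt)) =>
      (p.2.1 + p.2.2 + residueRep p.1, p.2.1 - p.2.2)) := by
  constructor
  · rintro ⟨c, k, l⟩ ⟨c', k', l'⟩ h
    simp only [Prod.mk.injEq] at h
    obtain ⟨h1, h2⟩ := h
    have h3 : (k + k) + residueRep c = (k' + k') + residueRep c' := by
      linear_combination h1 + h2
    have hc : c = c' := by
      have := congrArg residue h3
      rwa [residue_add, residue_add (k' + k'), residue_add_self, residue_add_self, zero_add,
        zero_add, residue_residueRep, residue_residueRep] at this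
    subst hc
    have hk : k = k' := by
      have h4 : k + k = k' + k' := add_right_cancel h3
      funext j
      have h5 := congrFun h4 j
      have h6 := congrArg Zsqrtd.re h5
      have h7 := congrArg Zsqrtd.im h5
      simp only [Pi.add_apply, Zsqrtd.re_add, Zsqrtd.im_add] at h6 h7
      ext <;> omega
    subst hk
    simpa using h2
  · rintro ⟨n, m⟩
    obtain ⟨k, hk⟩ := exists_eq_residueRep_add (n + m)
    refine ⟨(residue (n + m), k, k - m), ?_⟩
    simp only [Prod.mk.injEq]
    constructor
    · linear_combination -hk
    · abel

/-- In the double series put n = k + l + c and m = k - l. By the parallelogram law the exponents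
separate into forms of `2 W` at k + (α + c) / 2 and l + c / 2. The characters multiply to the value
at 2 k + c, hence at `c`, because a half-integral character is trivial on `2 ℤ[i]²`. -/
theorem thetaChar_half_sq {W : Matrix (Fin 2) (Fin 2) ℂ} (hW : W ∈ H2)
    (α β : Fin 2 → GaussianInt) :
    thetaChar ((1 / 2 : ℂ) • gaussVec α) ((1 / 2 : ℂ) • gaussVec β) W ^ 2 =
      ∑ c, latticeChar ((1 / 2 : ℂ) • gaussVec β) (residueRep c)
        * thetaHalf W (α + residueRep c) * thetaHalf W (residueRep c) := by
  set b := (1 / 2 : ℂ) • gaussVec β with hb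
  have hb2 : ∀ k, latticeChar b (k + k) = 1 := fun k => by
    rw [hb, latticeChar_half]
    refine Even.neg_one_zpow ⟨(β 0).re * (k 0).re + (β 0).im * (k 0).im
      + (β 1).re * (k 1).re + (β 1).im * (k 1).im, ?_⟩
    simp
    ring
  have hs := summable_norm_thetaSeries (fun n => (norm_latticeChar b n).le)
    ((1 / 2 : ℂ) • gaussVec α) hW
  have hone : ∀ n : Fin 2 → GaussianInt, ‖(1 : ℂ)‖ ≤ 1 := by simp
  have hs1 := fun v => summable_norm_thetaSeries hone v (two_smul_mem_H2 hW)
  rw [thetaChar_eq_thetaSeries, sq, thetaSeries, tsum_mul_tsum_of_summable_norm hs hs,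
    ← (Equiv.ofBijective _ halving_bijective).tsum_eq]
  have hterm : ∀ p : (Fin 2 → ZMod 2 × ZMod 2) ×
      ((Fin 2 → GaussianInt) × (Fin 2 → GaussianInt)),
      latticeChar b (p.2.1 + p.2.2 + residueRep p.1) * cexp (Real.pi * I * sesqForm W
          (gaussVec (p.2.1 + p.2.2 + residueRep p.1) + (1 / 2 : ℂ) • gaussVec α)) *
        (latticeChar b (p.2.1 - p.2.2) * cexp (Real.pi * I * sesqForm W
          (gaussVec (p.2.1 - p.2.2) + (1 / 2 : ℂ) • gaussVec α))) =
      latticeChar b (residueRep p.1) *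
        ((1 * cexp (Real.pi * I * sesqForm ((2 : ℂ) • W)
          (gaussVec p.2.1 + (1 / 2 : ℂ) • gaussVec (α + residueRep p.1)))) *
        (1 * cexp (Real.pi * I * sesqForm ((2 : ℂ) • W)
          (gaussVec p.2.2 + (1 / 2 : ℂ) • gaussVec (residueRep p.1))))) := by
    rintro ⟨c, k, l⟩
    have h1 : latticeChar b (k + l + residueRep c) * latticeChar b (k - l) =
        latticeChar b (residueRep c) := by
      rw [← latticeChar_add, show k + l + residueRep c + (k - l) = (k + k) + residueRep c by abel,
        latticeChar_add, hb2, one_mul]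
    have h2 := sesqForm_add_add_sesqForm_sub W
      (gaussVec k + (1 / 2 : ℂ) • gaussVec (α + residueRep c))
      (gaussVec l + (1 / 2 : ℂ) • gaussVec (residueRep c))
    simp only
    rw [mul_mul_mul_comm, h1, one_mul, one_mul, ← Complex.exp_add, ← Complex.exp_add, ← mul_add,
      ← mul_add, sesqForm_smul_left, sesqForm_smul_left, ← h2]
    congr 5
    · simp only [gaussVec_add]
      module
    · simp only [gaussVec_add, gaussVec_sub]
      module
  refine (tsum_congr hterm).trans ?_
  have hsum : Summable fun p : (Fin 2 → ZMod 2 × ZMod 2) ×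
      ((Fin 2 → GaussianInt) × (Fin 2 → GaussianInt)) =>
      latticeChar b (residueRep p.1) *
        ((1 * cexp (Real.pi * I * sesqForm ((2 : ℂ) • W)
          (gaussVec p.2.1 + (1 / 2 : ℂ) • gaussVec (α + residueRep p.1)))) *
        (1 * cexp (Real.pi * I * sesqForm ((2 : ℂ) • W)
          (gaussVec p.2.2 + (1 / 2 : ℂ) • gaussVec (residueRep p.1))))) := by
    have := (Equiv.ofBijective _ halving_bijective).summable_iff.2
      (summable_mul_of_summable_norm hs hs)
    exact this.congr fun p => (hterm p)
  rw [hsum.tsum_prod, tsum_fintype]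
  refine Finset.sum_congr rfl fun c _ => ?_
  simp only
  rw [tsum_mul_left, mul_assoc, thetaHalf, thetaHalf, thetaSeries, thetaSeries,
    tsum_mul_tsum_of_summable_norm (hs1 _) (hs1 _)]

theorem neg_one_zpow_eq_neg_of_odd_sub {k l : ℤ} (h : Odd (k - l)) :
    (-1 : ℂ) ^ k = -(-1) ^ l := by
  rw [← sub_add_cancel k l, zpow_add₀ (by norm_num), h.neg_one_zpow, neg_one_mul]

/-! ### Symmetry under multiplication by `i` and vanishing of the odd theta functions. -/

/-- The multiplication by `i` on `ℤ[i]² + (1 + i) / 2 · s`, as a permutation of `ℤ[i]²`. -/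
def rotation (s : Fin 2 → ℤ) : (Fin 2 → GaussianInt) ≃ (Fin 2 → GaussianInt) :=
  mulIEquiv.trans (Equiv.subRight fun j => (⟨s j, 0⟩ : GaussianInt))

/-- Since i (1 + i) / 2 = (1 + i) / 2 - 1, multiplication by `i` preserves the shifted lattice and
acts on the index as n ↦ i n - s. -/
theorem gaussVec_rotation_add (s : Fin 2 → ℤ) (n : Fin 2 → GaussianInt) :
    gaussVec (rotation s n) + (1 / 2 : ℂ) • (gaussVec fun j => ⟨s j, s j⟩)
      = I • (gaussVec n + (1 / 2 : ℂ) • gaussVec fun j => ⟨s j, s j⟩) := by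
  rw [rotation, Equiv.trans_apply, Equiv.subRight_apply, gaussVec_sub, gaussVec_mulIEquiv]
  funext j
  simp [gaussVec, GaussianInt.toComplex_def]
  linear_combination (-(s j : ℂ) / 2) * I_sq

theorem thetaSeries_rotation (ε : (Fin 2 → GaussianInt) → ℂ) (s : Fin 2 → ℤ)
    (W : Matrix (Fin 2) (Fin 2) ℂ) :
    thetaSeries (fun n => ε (rotation s n)) ((1 / 2 : ℂ) • gaussVec fun j => ⟨s j, s j⟩) W =
      thetaSeries ε ((1 / 2 : ℂ) • gaussVec fun j => ⟨s j, s j⟩) W := by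
  refine Eq.trans (tsum_congr fun n => ?_) ((rotation s).tsum_eq fun n => ε n *
    cexp (Real.pi * I * sesqForm W (gaussVec n + (1 / 2 : ℂ) • gaussVec fun j => ⟨s j, s j⟩)))
  rw [gaussVec_rotation_add, sesqForm_I_smul]

/-- Reindexing by `rotation` preserves the quadratic exponent, while the character changes by the
sign `(-1) ^ (s · t)`. So the series equals its negative. -/
theorem thetaChar_eq_zero_of_odd (W : Matrix (Fin 2) (Fin 2) ℂ) (s t : Fin 2 → ℤ)
    (hst : Odd (s 0 * t 0 + s 1 * t 1)) :
    thetaChar ((1 / 2 : ℂ) • gaussVec fun j => ⟨s j, s j⟩)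
      ((1 / 2 : ℂ) • gaussVec fun j => ⟨t j, t j⟩) W = 0 := by
  rw [thetaChar_eq_thetaSeries, ← self_eq_neg]
  conv_lhs => rw [← thetaSeries_rotation]
  rw [thetaSeries, thetaSeries, ← tsum_neg]
  refine tsum_congr fun n => ?_
  rw [latticeChar_half, latticeChar_half, ← neg_mul]
  congr 1
  refine neg_one_zpow_eq_neg_of_odd_sub ?_
  obtain ⟨k, hk⟩ := hst
  refine ⟨-(t 0 * (n 0).im) - t 1 * (n 1).im - k - 1, ?_⟩
  simp [rotation, mulIEquiv]
  linear_combination -hk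

/-- `thetaHalf` as a function of the residues modulo `2` of the real and imaginary parts. -/
def thetaRes (W : Matrix (Fin 2) (Fin 2) ℂ) (x y z t : ZMod 2) : ℂ :=
  thetaHalf W (residueRep ![(x, y), (z, t)])

/-- Modulo 2, multiplication by `i` exchanges real and imaginary parts. This leaves at most ten
distinct values among the sixteen. -/
theorem thetaRes_swap (W : Matrix (Fin 2) (Fin 2) ℂ) (x y z t : ZMod 2) :
    thetaRes W x y z t = thetaRes W y x t z := by
  rw [thetaRes, ← thetaHalf_mulIEquiv, ← thetaHalf_residueRep, thetaRes]
  congr 2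
  funext j
  fin_cases j <;> simp [residue, mulIEquiv, residueRep, CharTwo.neg_eq]

theorem sum_fin_two_arrow (f : (Fin 2 → ZMod 2 × ZMod 2) → ℂ) :
    ∑ c, f c = ∑ x, ∑ y, ∑ z, ∑ t, f ![(x, y), (z, t)] := by
  rw [← (finTwoArrowEquiv (ZMod 2 × ZMod 2)).symm.sum_comp, Fintype.sum_prod_type,
    Fintype.sum_prod_type]
  refine Finset.sum_congr rfl fun x _ => Finset.sum_congr rfl fun y _ => ?_
  rw [Fintype.sum_prod_type]
  rfl

theorem thetaChar_half_sq_eq_sum {W : Matrix (Fin 2) (Fin 2) ℂ} (hW : W ∈ H2)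
    (α β : Fin 2 → GaussianInt) :
    thetaChar ((1 / 2 : ℂ) • gaussVec α) ((1 / 2 : ℂ) • gaussVec β) W ^ 2 =
      ∑ x : ZMod 2, ∑ y : ZMod 2, ∑ z : ZMod 2, ∑ t : ZMod 2,
        (-1) ^ ((β 0).re * x.val + (β 0).im * y.val + (β 1).re * z.val + (β 1).im * t.val : ℤ) *
          thetaRes W ((α 0).re + x) ((α 0).im + y) ((α 1).re + z) ((α 1).im + t) *
          thetaRes W x y z t := by
  rw [thetaChar_half_sq hW, sum_fin_two_arrow]
  refine Finset.sum_congr rfl fun x _ => Finset.sum_congr rfl fun y _ =>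
    Finset.sum_congr rfl fun z _ => Finset.sum_congr rfl fun t _ => ?_
  rw [latticeChar_half, ← thetaHalf_residueRep W (α + _), residue_add, residue_residueRep, thetaRes,
    thetaRes]
  congr 3
  · congr 1
    funext j
    fin_cases j <;> simp [residue]

theorem sum_zmod_two (f : ZMod 2 → ℂ) : ∑ x, f x = f 0 + f 1 := Fin.sum_univ_two f

/-! ### The linear relations between the ten squares. -/

/-- The vector `((1 + i) s₁, (1 + i) s₂)`. -/
def diagVec (s t : ℤ) : Fin 2 → GaussianInt := ![⟨s, s⟩, ⟨t, t⟩]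

theorem half_smul_gaussVec_diagVec (s t : ℤ) :
    (1 / 2 : ℂ) • gaussVec (diagVec s t) = ((1 + I) / 2) • ![(s : ℂ), (t : ℂ)] := by
  funext j
  fin_cases j <;> simp [gaussVec, diagVec, GaussianInt.toComplex_def] <;> ring_nf

theorem Theta_eq_thetaChar_diagVec {r : ℕ} (s : Fin 4 → ℤ) (h : evenChar r = fun j => (s j : ℂ))
    (W : Matrix (Fin 2) (Fin 2) ℂ) :
    Theta r W = thetaChar ((1 / 2 : ℂ) • gaussVec (diagVec (s 0) (s 1)))
      ((1 / 2 : ℂ) • gaussVec (diagVec (s 2) (s 3))) W := by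
  rw [Theta, h, half_smul_gaussVec_diagVec, half_smul_gaussVec_diagVec]

theorem thetaChar_diagVec_eq_zero_of_odd (W : Matrix (Fin 2) (Fin 2) ℂ) (a b c d : ℤ)
    (h : Odd (a * c + b * d)) :
    thetaChar ((1 / 2 : ℂ) • gaussVec (diagVec a b)) ((1 / 2 : ℂ) • gaussVec (diagVec c d)) W
      = 0 := by
  have := thetaChar_eq_zero_of_odd W ![a, b] ![c, d] h
  convert this using 4 <;> funext j <;> fin_cases j <;> rfl

/-- The sixteen terms of `thetaChar_half_sq_eq_sum`, grouped under the multiplication by `i`. -/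
theorem thetaChar_half_sq_expand {W : Matrix (Fin 2) (Fin 2) ℂ} (hW : W ∈ H2)
    (a b c d e f g h : ℤ) :
    thetaChar ((1 / 2 : ℂ) • gaussVec ![⟨a, b⟩, ⟨c, d⟩])
        ((1 / 2 : ℂ) • gaussVec ![⟨e, f⟩, ⟨g, h⟩]) W ^ 2 =
      thetaRes W a b c d * thetaRes W 0 0 0 0
      + (-1) ^ h * thetaRes W a b c (d + 1) * thetaRes W 0 0 0 1
      + (-1) ^ g * thetaRes W a b (c + 1) d * thetaRes W 0 0 0 1
      + (-1) ^ (g + h) * thetaRes W a b (c + 1) (d + 1) * thetaRes W 0 0 1 1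
      + (-1) ^ f * thetaRes W a (b + 1) c d * thetaRes W 0 1 0 0
      + (-1) ^ (f + h) * thetaRes W a (b + 1) c (d + 1) * thetaRes W 0 1 0 1
      + (-1) ^ (f + g) * thetaRes W a (b + 1) (c + 1) d * thetaRes W 0 1 1 0
      + (-1) ^ (f + g + h) * thetaRes W a (b + 1) (c + 1) (d + 1) * thetaRes W 0 1 1 1
      + (-1) ^ e * thetaRes W (a + 1) b c d * thetaRes W 0 1 0 0
      + (-1) ^ (e + h) * thetaRes W (a + 1) b c (d + 1) * thetaRes W 0 1 1 0
      + (-1) ^ (e + g) * thetaRes W (a + 1) b (c + 1) d * thetaRes W 0 1 0 1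
      + (-1) ^ (e + g + h) * thetaRes W (a + 1) b (c + 1) (d + 1) * thetaRes W 0 1 1 1
      + (-1) ^ (e + f) * thetaRes W (a + 1) (b + 1) c d * thetaRes W 1 1 0 0
      + (-1) ^ (e + f + h) * thetaRes W (a + 1) (b + 1) c (d + 1) * thetaRes W 1 1 0 1
      + (-1) ^ (e + f + g) * thetaRes W (a + 1) (b + 1) (c + 1) d * thetaRes W 1 1 0 1
      + (-1) ^ (e + f + g + h) * thetaRes W (a + 1) (b + 1) (c + 1) (d + 1)
        * thetaRes W 1 1 1 1 := by
  have v1 : (1 : ZMod 2).val = 1 := rfl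
  rw [thetaChar_half_sq_eq_sum hW]
  simp only [sum_zmod_two, Matrix.cons_val_zero, Matrix.cons_val_one, ZMod.val_zero, v1,
    Nat.cast_zero, Nat.cast_one, mul_zero, mul_one, zero_add, add_zero, zpow_zero, one_mul,
    thetaRes_swap W 1 0, thetaRes_swap W 1 1 1 0, thetaRes_swap W 0 0 1 0]
  ring

/-- The first parameter of the linear relations between the squares of theta functions. -/
def paramA (W : Matrix (Fin 2) (Fin 2) ℂ) : ℂ :=
  thetaRes W 0 0 0 0 ^ 2 + thetaRes W 1 1 0 0 ^ 2 + thetaRes W 0 0 1 1 ^ 2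
    + thetaRes W 1 1 1 1 ^ 2

/-- The second parameter of the linear relations between the squares of theta functions. -/
def paramB (W : Matrix (Fin 2) (Fin 2) ℂ) : ℂ :=
  2 * (thetaRes W 0 0 0 0 * thetaRes W 0 0 1 1 + thetaRes W 1 1 0 0 * thetaRes W 1 1 1 1)

/-- The third parameter of the linear relations between the squares of theta functions. -/
def paramC (W : Matrix (Fin 2) (Fin 2) ℂ) : ℂ :=
  2 * (thetaRes W 0 0 0 0 * thetaRes W 1 1 0 0 + thetaRes W 0 0 1 1 * thetaRes W 1 1 1 1)

/-- The fourth parameter of the linear relations between the squares of theta functions. -/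
def paramD (W : Matrix (Fin 2) (Fin 2) ℂ) : ℂ :=
  2 * (thetaRes W 0 0 0 0 * thetaRes W 1 1 1 1 + thetaRes W 1 1 0 0 * thetaRes W 0 0 1 1)

/-- The fifth parameter of the linear relations between the squares of theta functions. -/
def paramE (W : Matrix (Fin 2) (Fin 2) ℂ) : ℂ :=
  4 * (thetaRes W 0 1 0 1 * thetaRes W 0 1 1 0)

/-- The duplication formula is applied to the six odd characteristics, whose squares vanish. Sums
and differences of two vanishing expansions with the same `a` separate the stated quadratic
relations. -/
theorem thetaRes_relations {W : Matrix (Fin 2) (Fin 2) ℂ} (hW : W ∈ H2) :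
    paramB W = 2 * (thetaRes W 0 0 0 1 ^ 2 + thetaRes W 1 1 0 1 ^ 2) ∧
    paramC W = 2 * (thetaRes W 0 1 0 0 ^ 2 + thetaRes W 0 1 1 1 ^ 2) ∧
    paramD W = 2 * (thetaRes W 0 1 0 1 ^ 2 + thetaRes W 0 1 1 0 ^ 2) ∧
    paramE W = 4 * (thetaRes W 0 1 0 0 * thetaRes W 0 1 1 1) ∧
    paramE W = 4 * (thetaRes W 0 0 0 1 * thetaRes W 1 1 0 1) := by
  have key : ∀ a b c d : ℤ, Odd (a * c + b * d) → _ = (0 : ℂ) := fun a b c d h =>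
    (thetaChar_half_sq_expand hW a a b b c c d d).symm.trans
      (by have := thetaChar_diagVec_eq_zero_of_odd W a b c d h
          rw [diagVec, diagVec] at this
          rw [this, zero_pow two_ne_zero])
  have z11 : (1 + 1 : ZMod 2) = 0 := rfl
  have o1 := key 1 0 1 0 (by decide)
  have o2 := key 1 0 1 1 (by decide)
  have o3 := key 0 1 0 1 (by decide)
  have o4 := key 0 1 1 1 (by decide)
  have o5 := key 1 1 1 0 (by decide)
  have o6 := key 1 1 0 1 (by decide)
  simp only [z11, thetaRes_swap W 1 0, thetaRes_swap W 1 1 1 0, thetaRes_swap W 0 0 1 0,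
    Int.cast_one, Int.cast_zero, zero_add, add_zero, zpow_zero, one_mul, zpow_one, Int.reduceAdd,
    neg_mul] at o1 o2 o3 o4 o5 o6
  norm_num [zpow_ofNat] at o1 o2 o3 o4 o5 o6
  simp only [paramB, paramC, paramD, paramE]
  refine ⟨?_, ?_, ?_, ?_, ?_⟩
  · linear_combination (o3 + o4) / 2
  · linear_combination (o1 + o2) / 2
  · linear_combination (o5 + o6) / 2
  · linear_combination -(o3 - o4) / 2
  · linear_combination -(o1 - o2) / 2

/-- The duplication formula for the ten even characteristics produces quadratic expressions in
`thetaRes`; the relations from the odd characteristics rewrite them in the five parameters. -/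
theorem linearRelations {W : Matrix (Fin 2) (Fin 2) ℂ} (hW : W ∈ H2) :
    LinearRelations W (paramA W) (paramB W) (paramC W) (paramD W) (paramE W) := by
  obtain ⟨hB, hC, hD, hE, hE'⟩ := thetaRes_relations hW
  have key : ∀ (r : ℕ) (s : Fin 4 → ℤ), (evenChar r = fun j => (s j : ℂ)) → _ := fun r s hr =>
    (congrArg (· ^ 2) (Theta_eq_thetaChar_diagVec s hr W)).trans
      (thetaChar_half_sq_expand hW (s 0) (s 0) (s 1) (s 1) (s 2) (s 2) (s 3) (s 3))
  have z11 : (1 + 1 : ZMod 2) = 0 := rfl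
  have e1 := key 1 ![1, 1, 1, 1] (by funext j; fin_cases j <;> simp [evenChar])
  have e2 := key 2 ![1, 1, 0, 0] (by funext j; fin_cases j <;> simp [evenChar])
  have e3 := key 3 ![1, 0, 0, 0] (by funext j; fin_cases j <;> simp [evenChar])
  have e4 := key 4 ![1, 0, 0, 1] (by funext j; fin_cases j <;> simp [evenChar])
  have e5 := key 5 ![0, 1, 0, 0] (by funext j; fin_cases j <;> simp [evenChar])
  have e6 := key 6 ![0, 0, 0, 0] (by funext j; fin_cases j <;> simp [evenChar])
  have e7 := key 7 ![0, 0, 0, 1] (by funext j; fin_cases j <;> simp [evenChar])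
  have e8 := key 8 ![0, 0, 1, 1] (by funext j; fin_cases j <;> simp [evenChar])
  have e9 := key 9 ![0, 0, 1, 0] (by funext j; fin_cases j <;> simp [evenChar])
  have e10 := key 10 ![0, 1, 1, 0] (by funext j; fin_cases j <;> simp [evenChar])
  simp only [z11, thetaRes_swap W 1 0, thetaRes_swap W 1 1 1 0, thetaRes_swap W 0 0 1 0,
    Int.cast_one, Int.cast_zero, zero_add, add_zero, zpow_zero, one_mul, zpow_one, Int.reduceAdd,
    neg_mul, Matrix.cons_val] at e1 e2 e3 e4 e5 e6 e7 e8 e9 e10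
  norm_num [zpow_ofNat] at e1 e2 e3 e4 e5 e6 e7 e8 e9 e10
  constructor
  · rw [e6, hB, hC, hD, paramA]; ring
  · rw [e7, hB, hC, hD, paramA]; ring
  · rw [e8, hB, hC, hD, paramA]; ring
  · rw [e9, hB, hC, hD, paramA]; ring
  · rw [e3]; linear_combination (norm := (simp only [paramC, paramE]; ring)) -hC - hE'
  · rw [e4]; linear_combination (norm := (simp only [paramC, paramE]; ring)) -hC + hE'
  · rw [e5]; linear_combination (norm := (simp only [paramB, paramE]; ring)) -hB - hE
  · rw [e10]; linear_combination (norm := (simp only [paramB, paramE]; ring)) -hB + hE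
  · rw [e2]; linear_combination (norm := (simp only [paramD, paramE]; ring)) -hD - hE - hE'
  · rw [e1]; linear_combination (norm := (simp only [paramD, paramE]; ring)) -hD + hE + hE'

/-! ### The weight four theta function as a product. -/

/-- The factors of the weight four theta function: the characteristics are
`a = (1 + i) / 2 · (k, k)` and `b = (1 / 2, 1 / 2)` or `b = (1 / 2, i / 2)`. -/
def weightFourFactor (k : ℤ) (c : GaussianInt) (W : Matrix (Fin 2) (Fin 2) ℂ) : ℂ :=
  thetaChar ((1 / 2 : ℂ) • gaussVec (diagVec k k)) ((1 / 2 : ℂ) • gaussVec ![⟨1, 0⟩, c]) W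

/-- The product of the four factors of the weight four theta function. -/
def weightFourProduct (W : Matrix (Fin 2) (Fin 2) ℂ) : ℂ :=
  weightFourFactor 0 ⟨1, 0⟩ W * weightFourFactor 0 ⟨0, 1⟩ W * weightFourFactor 1 ⟨1, 0⟩ W
    * weightFourFactor 1 ⟨0, 1⟩ W

/-- For each of the two `a`, the squares of the two factors have the form X + Y and X - Y with the
same Y up to sign. Their products are X² - Y², and Y² is the polynomial `paramD ^ 2 - paramE ^ 2`.
The claim becomes a factorisation of the discriminant. -/
theorem weightFourProduct_sq {W : Matrix (Fin 2) (Fin 2) ℂ} (hW : W ∈ H2) :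
    16 * weightFourProduct W ^ 2 =
      T W ^ 2 - 4 * Theta 6 W ^ 2 * Theta 7 W ^ 2 * Theta 8 W ^ 2 * Theta 9 W ^ 2 := by
  obtain ⟨hB, hC, hD, hE, hE'⟩ := thetaRes_relations hW
  have hl := linearRelations hW
  have z11 : (1 + 1 : ZMod 2) = 0 := rfl
  have key : ∀ (k : ℤ) (c : GaussianInt), weightFourFactor k c W ^ 2 = _ := fun k c =>
    thetaChar_half_sq_expand hW k k k k 1 0 c.re c.im
  have f1 := key 0 ⟨1, 0⟩
  have f2 := key 0 ⟨0, 1⟩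
  have f3 := key 1 ⟨1, 0⟩
  have f4 := key 1 ⟨0, 1⟩
  simp only [z11, thetaRes_swap W 1 0, thetaRes_swap W 1 1 1 0, thetaRes_swap W 0 0 1 0,
    Int.cast_one, Int.cast_zero, zero_add, add_zero, zpow_zero, one_mul, zpow_one, Int.reduceAdd,
    neg_mul] at f1 f2 f3 f4
  norm_num [zpow_ofNat] at f1 f2 f3 f4
  have hY : (2 * (thetaRes W 0 1 0 1 ^ 2 - thetaRes W 0 1 1 0 ^ 2)) ^ 2
      = paramD W ^ 2 - paramE W ^ 2 := by
    rw [hD, paramE]; ring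
  have f12 : weightFourFactor 0 ⟨1, 0⟩ W ^ 2 * weightFourFactor 0 ⟨0, 1⟩ W ^ 2 =
      (thetaRes W 0 0 0 0 ^ 2 + thetaRes W 1 1 1 1 ^ 2 - thetaRes W 1 1 0 0 ^ 2
        - thetaRes W 0 0 1 1 ^ 2) ^ 2 - (paramD W ^ 2 - paramE W ^ 2) := by
    rw [f1, f2, ← hY]; ring
  have f34 : weightFourFactor 1 ⟨1, 0⟩ W ^ 2 * weightFourFactor 1 ⟨0, 1⟩ W ^ 2 =
      4 * (thetaRes W 0 0 0 0 * thetaRes W 1 1 1 1 - thetaRes W 1 1 0 0 * thetaRes W 0 0 1 1) ^ 2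
        - (paramD W ^ 2 - paramE W ^ 2) := by
    rw [f3, f4, ← hY]; ring
  rw [hl.T_eq, hl.eq6, hl.eq7, hl.eq8, hl.eq9, weightFourProduct, mul_pow, mul_pow, mul_pow, f12,
    mul_assoc _ (_ ^ 2) (_ ^ 2), f34]
  simp only [paramA, paramB, paramC, paramD]
  ring

/-! ### Holomorphy of theta series. -/

/-- The value `x† W x` as a continuous linear function of `W`. -/
def sesqFormCLM (x : Fin 2 → ℂ) : (Fin 2 → Fin 2 → ℂ) →L[ℂ] ℂ :=
  LinearMap.mkContinuous
    { toFun := fun w => sesqForm (Matrix.of w) x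
      map_add' := fun w w' => by simp [sesqForm_apply]; ring
      map_smul' := fun u w => by simp [sesqForm_apply]; ring }
    (2 * lengthSq x) fun w => by
      have h : ∀ i j, ‖Matrix.of w i j‖ ≤ ‖w‖ := fun i j =>
        (norm_le_pi_norm (w i) j).trans (norm_le_pi_norm w i)
      refine (norm_sesqForm_le h x).trans (le_of_eq ?_)
      ring

theorem norm_sesqFormCLM_le (x : Fin 2 → ℂ) : ‖sesqFormCLM x‖ ≤ 2 * lengthSq x :=
  LinearMap.mkContinuous_norm_le _ (mul_nonneg zero_le_two (lengthSq_nonneg x)) _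

/-- Termwise differentiation. On a small ball the derivative of a term is at most 2 π l exp(-π δ l)
with `l` the squared length. One half of the exponential absorbs the factor π δ l / 2, which leaves
the summable majorant `u`. -/
theorem differentiableOn_thetaSeries {ε : (Fin 2 → GaussianInt) → ℂ} (hε : ∀ n, ‖ε n‖ ≤ 1)
    (v : Fin 2 → ℂ) :
    DifferentiableOn ℂ (fun w : Fin 2 → Fin 2 → ℂ => thetaSeries ε v (Matrix.of w))
      {w | Matrix.of w ∈ H2} := by
  intro w₀ hw₀
  obtain ⟨δ, hδ, r, hr, h⟩ := eventually_mul_lengthSq_le hw₀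
  refine DifferentiableAt.differentiableWithinAt ?_
  have hπ := Real.pi_pos
  refine (hasFDerivAt_tsum_of_isPreconnected (𝕜 := ℂ)
    (f := fun n w => ε n * cexp (Real.pi * I * sesqForm (Matrix.of w) (gaussVec n + v)))
    (f' := fun n w => ε n • cexp (Real.pi * I * sesqForm (Matrix.of w) (gaussVec n + v)) •
      ((Real.pi * I : ℂ) • sesqFormCLM (gaussVec n + v)))
    (u := fun n => 4 / δ * Real.exp (-(Real.pi * δ / 2) * lengthSq (gaussVec n + v)))
    (s := Metric.ball w₀ r) (x₀ := w₀) (x := w₀)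
    ((summable_exp_neg_mul_lengthSq (by positivity) v).mul_left _)
    Metric.isOpen_ball (convex_ball w₀ r).isPreconnected ?_ ?_ (Metric.mem_ball_self hr)
    (summable_norm_thetaSeries hε v hw₀).of_norm (Metric.mem_ball_self hr)).differentiableAt
  · intro n w _
    exact (((sesqFormCLM (gaussVec n + v)).hasFDerivAt.const_mul _).cexp).const_mul _
  · intro n w hw
    set l := lengthSq (gaussVec n + v) with hl
    have hl0 : 0 ≤ l := lengthSq_nonneg _
    have hwr : ∀ i j, ‖Matrix.of w i j - Matrix.of w₀ i j‖ ≤ r := fun i j => by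
      have h1 : ‖w - w₀‖ ≤ r := by
        rw [← dist_eq_norm]; exact (Metric.mem_ball.1 hw).le
      exact ((norm_le_pi_norm ((w - w₀) i) j).trans (norm_le_pi_norm (w - w₀) i)).trans h1
    have h1 := h _ hwr (gaussVec n + v)
    have hπI : ‖(Real.pi * I : ℂ)‖ = Real.pi := by simp [abs_of_pos hπ]
    rw [norm_smul, norm_smul, norm_smul, norm_exp_sesqForm, hπI]
    have e1 : Real.exp (-Real.pi * (sesqForm (Matrix.of w) (gaussVec n + v)).im) ≤
        Real.exp (-(Real.pi * δ / 2) * l) * Real.exp (-(Real.pi * δ / 2) * l) := by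
      rw [← Real.exp_add]
      refine Real.exp_le_exp.2 ?_
      nlinarith
    have e2 : Real.pi * δ / 2 * l ≤ Real.exp (Real.pi * δ / 2 * l) :=
      (le_add_of_nonneg_right zero_le_one).trans (Real.add_one_le_exp _)
    have e3 : Real.exp (-(Real.pi * δ / 2) * l) * Real.exp (Real.pi * δ / 2 * l) = 1 := by
      rw [← Real.exp_add]; simp
    calc _ ≤ 1 * (Real.exp (-(Real.pi * δ / 2) * l) * Real.exp (-(Real.pi * δ / 2) * l) *
          (Real.pi * (2 * l))) := by
          gcongr
          · exact hε n
          · exact norm_sesqFormCLM_le _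
      _ = 4 / δ * Real.exp (-(Real.pi * δ / 2) * l) * (Real.exp (-(Real.pi * δ / 2) * l) *
          (Real.pi * δ / 2 * l)) := by
          field_simp
          ring
      _ ≤ 4 / δ * Real.exp (-(Real.pi * δ / 2) * l) * (Real.exp (-(Real.pi * δ / 2) * l) *
          Real.exp (Real.pi * δ / 2 * l)) := by gcongr
      _ = _ := by rw [e3, mul_one]

theorem differentiableOn_thetaChar (a b : Fin 2 → ℂ) :
    DifferentiableOn ℂ (fun w : Fin 2 → Fin 2 → ℂ => thetaChar a b (Matrix.of w))
      {w | Matrix.of w ∈ H2} := by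
  simp only [thetaChar_eq_thetaSeries]
  exact differentiableOn_thetaSeries (fun n => (norm_latticeChar b n).le) a

/-! ### Expansion of theta series at the boundary point. -/

/-- The linear forms with `exp (π i L) = (Q₁, Q₂, -Q₃, -Q₄)`. -/
def logQ (W : Matrix (Fin 2) (Fin 2) ℂ) : Fin 4 → ℂ :=
  ![W 0 0 - (W 0 1 - I * W 1 0) / (1 - I), W 1 1 - (W 0 1 - I * W 1 0) / (1 - I),
    (W 0 1 + I * W 1 0) / (1 + I),
    (W 0 1 - I * W 1 0) / (1 - I) - (W 0 1 + I * W 1 0) / (1 + I)]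

/-- The monomial `exp (π i / 4 · ∑ Mₖ Lₖ)`. -/
def qMonomial (M : Fin 4 → ℤ) (W : Matrix (Fin 2) (Fin 2) ℂ) : ℂ :=
  cexp (Real.pi * I / 4 * ∑ k, (M k : ℂ) * logQ W k)

/-- Four times the exponents of the monomial of `x = N / 2`. -/
def qExponent (N : Fin 2 → GaussianInt) : Fin 4 → ℤ :=
  ![(N 0).re ^ 2 + (N 0).im ^ 2, (N 1).re ^ 2 + (N 1).im ^ 2,
    ((N 0).re + (N 1).re) ^ 2 + ((N 0).im + (N 1).im) ^ 2,
    (N 0).re ^ 2 + (N 0).im ^ 2 + (N 1).re ^ 2 + (N 1).im ^ 2 + (N 0).re * (N 1).re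
      + (N 0).im * (N 1).im + (N 0).re * (N 1).im - (N 0).im * (N 1).re]

/-- With x = N / 2 the exponents are |N₀|², |N₁|², |N₀ + N₁|² and (|N₀|² + |N₀ + (1 - i) N₁|²) / 2.
All are nonnegative, so theta series are power series in the fourth roots of the `±Qₖ`. -/
theorem qMonomial_qExponent (W : Matrix (Fin 2) (Fin 2) ℂ) (n μ : Fin 2 → GaussianInt) :
    cexp (Real.pi * I * sesqForm W (gaussVec n + (1 / 2 : ℂ) • gaussVec μ)) =
      qMonomial (qExponent (n + n + μ)) W := by
  have h1 : (1 - I) ≠ 0 := fun h => by simpa using congrArg Complex.re h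
  have h2 : (1 + I) ≠ 0 := fun h => by simpa using congrArg Complex.re h
  have hI : I ^ 2 = -1 := I_sq
  have e1 : (W 0 1 - I * W 1 0) / (1 - I) = (W 0 1 + W 1 0 + I * (W 0 1 - W 1 0)) / 2 := by
    rw [div_eq_div_iff h1 two_ne_zero]
    linear_combination (W 0 1 - W 1 0) * hI
  have e2 : (W 0 1 + I * W 1 0) / (1 + I) = (W 0 1 + W 1 0 - I * (W 0 1 - W 1 0)) / 2 := by
    rw [div_eq_div_iff h2 two_ne_zero]
    linear_combination (W 0 1 - W 1 0) * hI
  have hg : gaussVec n + (1 / 2 : ℂ) • gaussVec μ = (1 / 2 : ℂ) • gaussVec (n + n + μ) := by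
    rw [gaussVec_add, gaussVec_add]; module
  rw [qMonomial, hg, sesqForm_smul]
  generalize n + n + μ = N
  congr 1
  rw [sesqForm_apply]
  simp only [Fin.sum_univ_four, logQ, qExponent, Matrix.cons_val, e1, e2, gaussVec,
    GaussianInt.toComplex_def, star_add, star_mul', star_def, Complex.conj_I, map_intCast,
    map_div₀, map_one, map_ofNat]
  push_cast
  generalize ((N 0).re : ℂ) = a
  generalize ((N 0).im : ℂ) = b
  generalize ((N 1).re : ℂ) = c
  generalize ((N 1).im : ℂ) = d
  linear_combination (Real.pi * I / 4 * (-b ^ 2 * W 0 0 - d ^ 2 * W 1 1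
    - b * d * (W 0 1 + W 1 0))) * hI

theorem norm_qMonomial (M : Fin 4 → ℤ) (W : Matrix (Fin 2) (Fin 2) ℂ) :
    ‖qMonomial M W‖ = Real.exp (-(∑ k, (M k : ℝ) * (Real.pi / 4 * (logQ W k).im))) := by
  rw [qMonomial, Complex.norm_exp]
  congr 1
  simp [Fin.sum_univ_four]
  ring

theorem qMonomial_div (M M' : Fin 4 → ℤ) (W : Matrix (Fin 2) (Fin 2) ℂ) :
    qMonomial M W / qMonomial M' W = qMonomial (M - M') W := by
  rw [qMonomial, qMonomial, qMonomial, ← Complex.exp_sub]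
  congr 1
  simp [Fin.sum_univ_four]
  ring

theorem Q_eq (W : Matrix (Fin 2) (Fin 2) ℂ) (k : Fin 4) :
    Q W k = ![1, 1, -1, -1] k * cexp (Real.pi * I * logQ W k) := by
  fin_cases k <;> simp [Q, q, logQ, ← Complex.exp_sub, mul_sub]

theorem tendsto_im_logQ (k : Fin 4) :
    Tendsto (fun W => Real.pi / 4 * (logQ W k).im) toBoundary atTop := by
  have h1 : Tendsto (fun W => ‖Q W k‖) toBoundary (𝓝 0) := by
    have h2 : Tendsto Q toBoundary (𝓝 0) := tendsto_comap.mono_left inf_le_left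
    simpa using ((continuous_apply k).tendsto _).comp h2 |>.norm
  have h3 : ∀ W, ‖Q W k‖ = Real.exp (-4 * (Real.pi / 4 * (logQ W k).im)) := fun W => by
    rw [Q_eq, norm_mul, Complex.norm_exp]
    have : ‖(![1, 1, -1, -1] k : ℂ)‖ = 1 := by fin_cases k <;> simp
    rw [this, one_mul]
    congr 1
    simp
    ring
  simp only [h3, Real.tendsto_exp_comp_nhds_zero] at h1
  exact (tendsto_const_mul_atBot_of_neg (by norm_num)).1 h1

/-- If `M` bounds every occurring exponent vector from below, then after division by the monomial of
`M` each term is either constant or tends to 0. -/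
theorem tendsto_thetaSeries_div {ε : (Fin 2 → GaussianInt) → ℂ} (hε : ∀ n, ‖ε n‖ ≤ 1)
    (μ : Fin 2 → GaussianInt) (M : Fin 4 → ℤ)
    (hM : ∀ n, ε n ≠ 0 → ∀ k, M k ≤ qExponent (n + n + μ) k) :
    Tendsto (fun W => thetaSeries ε ((1 / 2 : ℂ) • gaussVec μ) W / qMonomial M W) toBoundary
      (𝓝 (∑' n, if qExponent (n + n + μ) = M then ε n else 0)) := by
  have heq : ∀ W, thetaSeries ε ((1 / 2 : ℂ) • gaussVec μ) W / qMonomial M W =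
      ∑' n, ε n * qMonomial (qExponent (n + n + μ) - M) W := fun W => by
    rw [thetaSeries, ← tsum_div_const]
    refine tsum_congr fun n => ?_
    rw [qMonomial_qExponent, mul_div_assoc, qMonomial_div]
  simp only [heq]
  have hev : ∀ k, ∀ᶠ W in toBoundary, 1 ≤ Real.pi / 4 * (logQ W k).im := fun k =>
    (tendsto_im_logQ k).eventually_ge_atTop 1
  -- Once all π / 4 · Im Lₖ are at least 1, a term is bounded by exp of minus the sum of its excess
  -- exponents. Only the first two are kept, whose exponents add up to 4 |x|².
  refine tendsto_tsum_of_dominated_convergence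
    (bound := fun n => Real.exp (M 0 + M 1) *
      Real.exp (-4 * lengthSq (gaussVec n + (1 / 2 : ℂ) • gaussVec μ)))
    ((summable_exp_neg_mul_lengthSq (by norm_num) _).mul_left _) (fun n => ?_) ?_
  · by_cases h0 : ε n = 0
    · simp only [h0, zero_mul, ite_self]
      exact tendsto_const_nhds
    split_ifs with h
    · rw [h, sub_self]
      simpa [qMonomial] using tendsto_const_nhds
    · obtain ⟨k, hk⟩ := Function.ne_iff.1 h
      have hk' : 0 < qExponent (n + n + μ) k - M k := sub_pos.2 (lt_of_le_of_ne (hM n h0 k) hk.symm)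
      refine squeeze_zero_norm' (a := fun W => Real.exp (-(Real.pi / 4 * (logQ W k).im))) ?_ ?_
      · filter_upwards [hev 0, hev 1, hev 2, hev 3] with W w0 w1 w2 w3
        have hw : ∀ j, 1 ≤ Real.pi / 4 * (logQ W j).im := by
          intro j; fin_cases j <;> assumption
        rw [norm_mul, norm_qMonomial]
        refine (mul_le_of_le_one_left (Real.exp_pos _).le (hε n)).trans (Real.exp_le_exp.2 ?_)
        refine neg_le_neg ?_
        refine le_trans ?_ (Finset.single_le_sum (f := fun j =>
          (((qExponent (n + n + μ) - M) j : ℤ) : ℝ) * (Real.pi / 4 * (logQ W j).im))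
          (fun j _ => mul_nonneg ?_ (zero_le_one.trans (hw j))) (Finset.mem_univ k))
        · refine le_mul_of_one_le_left (zero_le_one.trans (hw k)) ?_
          exact_mod_cast hk'
        · exact_mod_cast sub_nonneg.2 (hM n h0 j)
      · exact Real.tendsto_exp_atBot.comp (tendsto_neg_atTop_atBot.comp (tendsto_im_logQ k))
  · filter_upwards [hev 0, hev 1, hev 2, hev 3] with W w0 w1 w2 w3 n
    by_cases h0 : ε n = 0
    · simp only [h0, zero_mul, norm_zero]; positivity
    rw [norm_mul, norm_qMonomial, ← Real.exp_add]
    refine (mul_le_of_le_one_left (Real.exp_pos _).le (hε n)).trans (Real.exp_le_exp.2 ?_)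
    have hl : 4 * lengthSq (gaussVec n + (1 / 2 : ℂ) • gaussVec μ) =
        (qExponent (n + n + μ) 0 : ℝ) + qExponent (n + n + μ) 1 := by
      have e : ∀ z w : GaussianInt,
          4 * ‖GaussianInt.toComplex z + 1 / 2 * GaussianInt.toComplex w‖ ^ 2 = ((z + z + w).re : ℝ) ^ 2 + ((z + z + w).im : ℝ) ^ 2 := fun z w => by
        rw [← Complex.normSq_eq_norm_sq, Complex.normSq_apply]
        simp
        ring
      rw [lengthSq, mul_add]
      simp only [Pi.add_apply, Pi.smul_apply, smul_eq_mul, gaussVec, e, qExponent,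
        Matrix.cons_val]
      push_cast
      rfl
    have hs : ∀ j, (0 : ℝ) ≤ qExponent (n + n + μ) j - M j := fun j => by
      exact_mod_cast sub_nonneg.2 (hM n h0 j)
    simp only [Fin.sum_univ_four, Pi.sub_apply, Int.cast_sub]
    have t0 := mul_le_mul_of_nonneg_left w0 (hs 0)
    have t1 := mul_le_mul_of_nonneg_left w1 (hs 1)
    have t2 := mul_le_mul_of_nonneg_left w2 (hs 2)
    have t3 := mul_le_mul_of_nonneg_left w3 (hs 3)
    linarith [hs 2, hs 3]

/-- In the applications the shifted component has minimal value ±1 ± i, that is `p, q ∈ {0, -1}`,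
and the other component is a function of it. The four minimal vectors carry equal coefficients,
whence `4 * κ`. -/
theorem tendsto_thetaSeries_div_of_image {ε : (Fin 2 → GaussianInt) → ℂ} (hε : ∀ n, ‖ε n‖ ≤ 1)
    (μ : Fin 2 → GaussianInt) (M : Fin 4 → ℤ) (φ : ℤ → ℤ → Fin 2 → GaussianInt) (j : Fin 2)
    (hφ : ∀ p q, φ p q j = ⟨p, q⟩) (κ : ℂ)
    (hM : ∀ n, ε n ≠ 0 → ∀ k, M k ≤ qExponent (n + n + μ) k)
    (hφM : ∀ n, qExponent (n + n + μ) = M →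
      ((n j).re = 0 ∨ (n j).re = -1) ∧ ((n j).im = 0 ∨ (n j).im = -1) ∧
        (ε n ≠ 0 → n = φ (n j).re (n j).im))
    (hκ : ∀ p q, (p = 0 ∨ p = -1) → (q = 0 ∨ q = -1) →
      qExponent (φ p q + φ p q + μ) = M ∧ ε (φ p q) = κ) :
    Tendsto (fun W => thetaSeries ε ((1 / 2 : ℂ) • gaussVec μ) W / qMonomial M W) toBoundary
      (𝓝 (4 * κ)) := by
  have h := tendsto_thetaSeries_div hε μ M hM
  have hinj : Function.Injective fun x : ℤ × ℤ => φ x.1 x.2 := fun x y hxy => by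
    have h1 := congrFun hxy j
    simp only [hφ] at h1
    exact Prod.ext (congrArg Zsqrtd.re h1) (congrArg Zsqrtd.im h1)
  have hsum : ∑' n, (if qExponent (n + n + μ) = M then ε n else 0) =
      ∑ x ∈ ({0, -1} : Finset ℤ) ×ˢ ({0, -1} : Finset ℤ), κ := by
    rw [tsum_eq_sum (s := (({0, -1} : Finset ℤ) ×ˢ ({0, -1} : Finset ℤ)).image
      fun x : ℤ × ℤ => φ x.1 x.2), Finset.sum_image hinj.injOn]
    · refine Finset.sum_congr rfl fun x hx => ?_
      simp only [Finset.mem_product, Finset.mem_insert, Finset.mem_singleton] at hx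
      obtain ⟨h1, h2⟩ := hκ x.1 x.2 hx.1 hx.2
      rw [if_pos h1, h2]
    · intro n hn
      split_ifs with hnM
      · by_contra h0
        obtain ⟨h1, h2, h3⟩ := hφM n hnM
        refine hn (Finset.mem_image.2 ⟨((n j).re, (n j).im), ?_, (h3 h0).symm⟩)
        simp [h1, h2]
      · rfl
  rw [hsum] at h
  simpa using h

/-! ### Minimal exponents and leading coefficients. -/

theorem mul_succ_nonneg (x : ℤ) : 0 ≤ x * (x + 1) := by
  rcases le_or_gt 0 x with hx | hx
  · positivity
  · exact mul_nonneg_of_nonpos_of_nonpos hx.le (by omega)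

theorem two_le_sq_add_sq_of_odd (p q : ℤ) : 2 ≤ (p + p + 1) ^ 2 + (q + q + 1) ^ 2 := by
  nlinarith [mul_succ_nonneg p, mul_succ_nonneg q]

theorem eq_of_sq_add_sq_eq_two {p q : ℤ} (h : (p + p + 1) ^ 2 + (q + q + 1) ^ 2 = 2) :
    (p = 0 ∨ p = -1) ∧ (q = 0 ∨ q = -1) := by
  have e : ∀ x : ℤ, x * (x + 1) = 0 → x = 0 ∨ x = -1 := fun x h => by
    rcases mul_eq_zero.1 h with h | h <;> omega
  have hp := mul_succ_nonneg p
  have hq := mul_succ_nonneg q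
  exact ⟨e p (by nlinarith), e q (by nlinarith)⟩

/-- Lower bounds for the fourth exponent. -/
theorem two_mul_qExponent_three (N : Fin 2 → GaussianInt) :
    2 * qExponent N 3 = qExponent N 0 + (((N 0).re + (N 1).re + (N 1).im) ^ 2
        + ((N 0).im + (N 1).im - (N 1).re) ^ 2) ∧
    2 * qExponent N 3 = qExponent N 1 + (((N 1).re + (N 0).re - (N 0).im) ^ 2
        + ((N 1).im + (N 0).re + (N 0).im) ^ 2) := by
  constructor <;> simp [qExponent] <;> ring

theorem even_qExponent_three (n : Fin 2 → GaussianInt) (s t : ℤ) :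
    Even (qExponent (n + n + diagVec s t) 3) := by
  simp [qExponent, diagVec, parity_simps]

/-- Twice the fourth exponent bounds the first two from above, which gives only a lower bound 1;
parity raises it to 2. -/
theorem two_le_qExponent_three (n : Fin 2 → GaussianInt) (s t : ℤ)
    (h : 2 ≤ qExponent (n + n + diagVec s t) 0 ∨ 2 ≤ qExponent (n + n + diagVec s t) 1) :
    2 ≤ qExponent (n + n + diagVec s t) 3 := by
  obtain ⟨k, hk⟩ := even_qExponent_three n s t
  obtain ⟨h1, h2⟩ := two_mul_qExponent_three (n + n + diagVec s t)
  have h3 : qExponent (n + n + diagVec s t) 0 ≤ 2 * qExponent (n + n + diagVec s t) 3 := by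
    rw [h1]; exact le_add_of_nonneg_right (by positivity)
  have h4 : qExponent (n + n + diagVec s t) 1 ≤ 2 * qExponent (n + n + diagVec s t) 3 := by
    rw [h2]; exact le_add_of_nonneg_right (by positivity)
  omega

theorem qExponent_nonneg (N : Fin 2 → GaussianInt) (k : Fin 4) : 0 ≤ qExponent N k := by
  obtain ⟨h1, -⟩ := two_mul_qExponent_three N
  have h0 : 0 ≤ qExponent N 0 := by simp only [qExponent, Matrix.cons_val]; positivity
  fin_cases k
  · exact h0
  · change 0 ≤ qExponent N 1
    simp only [qExponent, Matrix.cons_val]; positivity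
  · change 0 ≤ qExponent N 2
    simp only [qExponent, Matrix.cons_val]; positivity
  · change 0 ≤ qExponent N 3
    nlinarith

theorem tendsto_thetaChar_zero (b : Fin 2 → ℂ) :
    Tendsto (thetaChar 0 b) toBoundary (𝓝 1) := by
  have h := tendsto_thetaSeries_div (fun n => (norm_latticeChar b n).le) 0 0
    fun n _ k => qExponent_nonneg _ k
  rw [tsum_eq_single 0] at h
  · have h1 : latticeChar b 0 = 1 := by simp [latticeChar, gaussVec, dotProduct]
    have h2 : qExponent 0 = 0 := by
      funext k; fin_cases k <;> simp [qExponent]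
    have h3 : (1 / 2 : ℂ) • gaussVec 0 = 0 := by
      funext j; simp [gaussVec]
    have h4 : ∀ W, qMonomial 0 W = 1 := fun W => by simp [qMonomial]
    simp only [add_zero, h2, if_true, h1, h3, h4, div_one] at h
    exact h.congr fun W => (thetaChar_eq_thetaSeries 0 b W).symm
  · intro n hn
    refine if_neg fun h => hn ?_
    have h0 := congrFun h 0
    have h1 := congrFun h 1
    simp only [qExponent, Matrix.cons_val, Pi.add_apply, Pi.zero_apply, Zsqrtd.re_add,
      Zsqrtd.im_add, add_zero] at h0 h1
    have e : ∀ x y : ℤ, (x + x) ^ 2 + (y + y) ^ 2 = 0 → x = 0 ∧ y = 0 := fun x y h => by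
      constructor <;> nlinarith [sq_nonneg x, sq_nonneg y]
    funext j
    fin_cases j
    · exact Zsqrtd.ext (e _ _ h0).1 (e _ _ h0).2
    · exact Zsqrtd.ext (e _ _ h1).1 (e _ _ h1).2

/-- The leading coefficient of a theta function with characteristic `a = (1 + i) / 2 · (1, 0)`. -/
theorem tendsto_thetaChar_one_zero (t : ℤ) :
    Tendsto (fun W => thetaChar ((1 / 2 : ℂ) • gaussVec (diagVec 1 0))
      ((1 / 2 : ℂ) • gaussVec (diagVec 0 t)) W / qMonomial ![2, 0, 2, 2] W) toBoundary (𝓝 4) := by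
  simp only [thetaChar_eq_thetaSeries]
  rw [← mul_one (4 : ℂ)]
  have hodd : ∀ n : Fin 2 → GaussianInt, 2 ≤ qExponent (n + n + diagVec 1 0) 0 := fun n => by
    simpa [qExponent, diagVec] using two_le_sq_add_sq_of_odd (n 0).re (n 0).im
  refine tendsto_thetaSeries_div_of_image (fun n => (norm_latticeChar _ n).le) _ _
    (fun p q => ![⟨p, q⟩, 0]) 0 (fun p q => rfl) 1 (fun n _ k => ?_) (fun n h => ?_) ?_
  · fin_cases k
    · exact hodd n
    · exact qExponent_nonneg _ 1
    · have := two_le_sq_add_sq_of_odd ((n 0).re + (n 1).re) ((n 0).im + (n 1).im)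
      simp [qExponent, diagVec]
      nlinarith
    · exact two_le_qExponent_three n 1 0 (Or.inl (hodd n))
  · have h0 := congrFun h 0
    have h1 := congrFun h 1
    simp [qExponent, diagVec] at h0 h1
    obtain ⟨hp, hq⟩ := eq_of_sq_add_sq_eq_two h0
    refine ⟨hp, hq, fun _ => ?_⟩
    funext j
    fin_cases j
    · rfl
    · refine Zsqrtd.ext ?_ ?_ <;> simp <;> nlinarith [sq_nonneg (n 1).re, sq_nonneg (n 1).im]
  · rintro p q hp hq
    constructor
    · funext k
      rcases hp with rfl | rfl <;> rcases hq with rfl | rfl <;> fin_cases k <;>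
        simp [qExponent, diagVec]
    · rw [latticeChar_half]
      simp [diagVec]

/-- The leading coefficient of a theta function with characteristic `a = (1 + i) / 2 · (0, 1)`. -/
theorem tendsto_thetaChar_zero_one (t : ℤ) :
    Tendsto (fun W => thetaChar ((1 / 2 : ℂ) • gaussVec (diagVec 0 1))
      ((1 / 2 : ℂ) • gaussVec (diagVec t 0)) W / qMonomial ![0, 2, 2, 2] W) toBoundary (𝓝 4) := by
  simp only [thetaChar_eq_thetaSeries]
  rw [← mul_one (4 : ℂ)]
  have hodd : ∀ n : Fin 2 → GaussianInt, 2 ≤ qExponent (n + n + diagVec 0 1) 1 := fun n => by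
    simpa [qExponent, diagVec] using two_le_sq_add_sq_of_odd (n 1).re (n 1).im
  refine tendsto_thetaSeries_div_of_image (fun n => (norm_latticeChar _ n).le) _ _
    (fun p q => ![0, ⟨p, q⟩]) 1 (fun p q => rfl) 1 (fun n _ k => ?_) (fun n h => ?_) ?_
  · fin_cases k
    · exact qExponent_nonneg _ 0
    · exact hodd n
    · have := two_le_sq_add_sq_of_odd ((n 0).re + (n 1).re) ((n 0).im + (n 1).im)
      simp [qExponent, diagVec]
      nlinarith
    · exact two_le_qExponent_three n 0 1 (Or.inr (hodd n))
  · have h0 := congrFun h 0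
    have h1 := congrFun h 1
    simp [qExponent, diagVec] at h0 h1
    obtain ⟨hp, hq⟩ := eq_of_sq_add_sq_eq_two h1
    refine ⟨hp, hq, fun _ => ?_⟩
    funext j
    fin_cases j
    · refine Zsqrtd.ext ?_ ?_ <;> simp <;> nlinarith [sq_nonneg (n 0).re, sq_nonneg (n 0).im]
    · rfl
  · rintro p q hp hq
    constructor
    · funext k
      rcases hp with rfl | rfl <;> rcases hq with rfl | rfl <;> fin_cases k <;>
        simp [qExponent, diagVec]
    · rw [latticeChar_half]
      simp [diagVec]

/-- The leading coefficient of a theta function with characteristic `a = (1 + i) / 2 · (1, 1)`. -/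
theorem tendsto_thetaChar_one_one (β : Fin 2 → GaussianInt) (κ : ℂ)
    (hκ : ∀ p q, latticeChar ((1 / 2 : ℂ) • gaussVec β) ![⟨p, q⟩, ⟨-p - 1, -q - 1⟩] = κ) :
    Tendsto (fun W => thetaChar ((1 / 2 : ℂ) • gaussVec (diagVec 1 1))
      ((1 / 2 : ℂ) • gaussVec β) W / qMonomial ![2, 2, 0, 2] W) toBoundary (𝓝 (4 * κ)) := by
  simp only [thetaChar_eq_thetaSeries]
  have hodd : ∀ n : Fin 2 → GaussianInt, 2 ≤ qExponent (n + n + diagVec 1 1) 0 := fun n => by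
    simpa [qExponent, diagVec] using two_le_sq_add_sq_of_odd (n 0).re (n 0).im
  refine tendsto_thetaSeries_div_of_image (fun n => (norm_latticeChar _ n).le) _ _
    (fun p q => ![⟨p, q⟩, ⟨-p - 1, -q - 1⟩]) 0 (fun p q => rfl) κ (fun n _ k => ?_)
    (fun n h => ?_) ?_
  · fin_cases k
    · exact hodd n
    · simpa [qExponent, diagVec] using two_le_sq_add_sq_of_odd (n 1).re (n 1).im
    · exact qExponent_nonneg _ 2
    · exact two_le_qExponent_three n 1 1 (Or.inl (hodd n))
  · have h0 := congrFun h 0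
    have h2 := congrFun h 2
    simp [qExponent, diagVec] at h0 h2
    obtain ⟨hp, hq⟩ := eq_of_sq_add_sq_eq_two h0
    refine ⟨hp, hq, fun _ => ?_⟩
    have e : ∀ x y : ℤ, x ^ 2 + y ^ 2 = 0 → x = 0 ∧ y = 0 := fun x y h => by
      constructor <;> nlinarith [sq_nonneg x, sq_nonneg y]
    obtain ⟨e1, e2⟩ := e _ _ h2
    funext j
    fin_cases j
    · rfl
    · refine Zsqrtd.ext ?_ ?_ <;> simp <;> linarith
  · rintro p q hp hq
    refine ⟨?_, hκ p q⟩
    funext k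
    rcases hp with rfl | rfl <;> rcases hq with rfl | rfl <;> fin_cases k <;>
      simp [qExponent, diagVec]

theorem norm_half_le {x y : ℂ} (hx : ‖x‖ ≤ 1) (hy : ‖y‖ ≤ 1) : ‖(x + y) / 2‖ ≤ 1 := by
  rw [norm_div]
  have := norm_add_le x y
  simp
  linarith

/-- The leading coefficient of the difference `Θ₃ - Θ₄`. -/
theorem tendsto_thetaChar_sub :
    Tendsto (fun W => (thetaChar ((1 / 2 : ℂ) • gaussVec (diagVec 1 0))
        ((1 / 2 : ℂ) • gaussVec (diagVec 0 0)) W - thetaChar ((1 / 2 : ℂ) • gaussVec (diagVec 1 0))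
        ((1 / 2 : ℂ) • gaussVec (diagVec 0 1)) W) / 2 / qMonomial ![2, 4, 2, 2] W)
      toBoundary (𝓝 4) := by
  set χ := latticeChar ((1 / 2 : ℂ) • gaussVec (diagVec 0 1)) with hχ
  have hχn : ∀ n, χ n = (-1) ^ ((n 1).re + (n 1).im) := fun n => by
    rw [hχ, latticeChar_half]; simp [diagVec]
  have h1n : ∀ n, latticeChar ((1 / 2 : ℂ) • gaussVec (diagVec 0 0)) n = 1 := fun n => by
    rw [latticeChar_half]; simp [diagVec]
  have heven : ∀ n, (1 + -χ n) / 2 ≠ 0 → Odd ((n 1).re + (n 1).im) := fun n hn => by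
    by_contra ho
    rw [hχn, (Int.not_odd_iff_even.1 ho).neg_one_zpow] at hn
    simp at hn
  have hodd : ∀ n : Fin 2 → GaussianInt, 2 ≤ qExponent (n + n + diagVec 1 0) 0 := fun n => by
    simpa [qExponent, diagVec] using two_le_sq_add_sq_of_odd (n 0).re (n 0).im
  -- In the difference only terms with an odd value of `(n 1).re + (n 1).im` survive, so the former
  -- minimum N₁ = 0 is lost. The new minimal vectors are those with |N₀|² = 2 and N₁ = -(1 + i) N₀.
  have h := tendsto_thetaSeries_div_of_image (ε := fun n => (1 + -χ n) / 2)
    (fun n => norm_half_le (by simp) (by rw [norm_neg]; exact (norm_latticeChar _ n).le))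
    (diagVec 1 0) ![2, 4, 2, 2] (fun p q => ![⟨p, q⟩, ⟨q - p, -p - q - 1⟩]) 0 (fun p q => rfl) 1
    (fun n hn k => ?_) (fun n h => ?_) ?_
  · rw [mul_one] at h
    refine h.congr' ?_
    filter_upwards [show H2 ∈ toBoundary from mem_inf_of_right (mem_principal_self _)] with W hW
    have hs : ∀ b, Summable fun n => latticeChar b n * cexp (Real.pi * I * sesqForm W
        (gaussVec n + (1 / 2 : ℂ) • gaussVec (diagVec 1 0))) := fun b =>
      (summable_norm_thetaSeries (fun n => (norm_latticeChar b n).le)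
        ((1 / 2 : ℂ) • gaussVec (diagVec 1 0)) hW).of_norm
    rw [thetaChar_eq_thetaSeries, thetaChar_eq_thetaSeries, thetaSeries, thetaSeries, thetaSeries,
      ← (hs _).tsum_sub (hs _), ← tsum_div_const, ← tsum_div_const, ← tsum_div_const]
    refine tsum_congr fun n => ?_
    rw [h1n]
    ring
  · have ho := heven n hn
    fin_cases k
    · exact hodd n
    · simp [qExponent, diagVec]
      have : (n 1).re ≠ 0 ∨ (n 1).im ≠ 0 := by
        by_contra hc
        push Not at hc
        rw [hc.1, hc.2] at ho
        simp at ho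
      rcases this with h | h
      · have := pow_pos (abs_pos.2 h) 2
        rw [sq_abs] at this
        nlinarith [sq_nonneg (n 1).im]
      · have := pow_pos (abs_pos.2 h) 2
        rw [sq_abs] at this
        nlinarith [sq_nonneg (n 1).re]
    · have := two_le_sq_add_sq_of_odd ((n 0).re + (n 1).re) ((n 0).im + (n 1).im)
      simp [qExponent, diagVec]
      nlinarith
    · exact two_le_qExponent_three n 1 0 (Or.inl (hodd n))
  · have h0 := congrFun h 0
    have h1 := congrFun h 1
    have h2 := congrFun h 2
    have h3 := congrFun h 3
    simp [qExponent, diagVec] at h0 h1 h2 h3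
    obtain ⟨hp, hq⟩ := eq_of_sq_add_sq_eq_two h0
    refine ⟨hp, hq, fun _ => ?_⟩
    have hlin : (n 1).re = (n 0).im - (n 0).re ∧ (n 1).im = -(n 0).re - (n 0).im - 1 := by
      rcases hp with hp | hp <;> rcases hq with hq | hq <;> rw [hp, hq] at h2 h3 ⊢ <;>
        constructor <;> nlinarith
    funext j
    fin_cases j
    · rfl
    · exact Zsqrtd.ext hlin.1 hlin.2
  · rintro p q hp hq
    constructor
    · funext k
      rcases hp with rfl | rfl <;> rcases hq with rfl | rfl <;> fin_cases k <;>
        simp [qExponent, diagVec]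
    · rw [hχn]
      rcases hp with rfl | rfl <;> rcases hq with rfl | rfl <;> norm_num [zpow_neg]

/-- The leading coefficient of the last factor of the weight four theta function. -/
theorem tendsto_weightFourFactor_one_I :
    Tendsto (fun W => weightFourFactor 1 ⟨0, 1⟩ W / qMonomial ![2, 2, 4, 2] W)
      toBoundary (𝓝 (-4)) := by
  set χ := latticeChar ((1 / 2 : ℂ) • gaussVec ![⟨1, 0⟩, ⟨0, 1⟩]) with hχ
  -- The coefficients on the vectors N₁ = -N₀ of lowest exponent cancel. Averaging `χ` over `σ`,
  -- which does not change the series, removes these terms. The next minimum is attained for |N₀|² =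
  -- 2 and N₁ = -i N₀.
  set σ := rotation (fun _ => 1) with hσ
  have hχn : ∀ n, χ n = (-1) ^ ((n 0).re + (n 1).im) := fun n => by
    rw [hχ, latticeChar_half]; simp
  have hσn : ∀ n, χ (σ n) = (-1) ^ (-(n 0).im - 1 + (n 1).re) := fun n => by
    rw [hχn]; simp [hσ, rotation, mulIEquiv]
  have hparity : ∀ n, (χ n + χ (σ n)) / 2 ≠ 0 →
      Odd ((n 0).re + (n 0).im + (n 1).re + (n 1).im) := fun n hn => by
    by_contra ho
    obtain ⟨k, hk⟩ := Int.not_odd_iff_even.1 ho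
    refine hn ?_
    rw [hχn, hσn, neg_one_zpow_eq_neg_of_odd_sub (l := -(n 0).im - 1 + (n 1).re)
      ⟨k - (n 1).re, by linarith⟩]
    simp
  have hodd : ∀ n : Fin 2 → GaussianInt, 2 ≤ qExponent (n + n + diagVec 1 1) 0 := fun n => by
    simpa [qExponent, diagVec] using two_le_sq_add_sq_of_odd (n 0).re (n 0).im
  have h := tendsto_thetaSeries_div_of_image (ε := fun n => (χ n + χ (σ n)) / 2)
    (fun n => norm_half_le (norm_latticeChar _ n).le (norm_latticeChar _ _).le)
    (diagVec 1 1) ![2, 2, 4, 2] (fun p q => ![⟨p, q⟩, ⟨q, -p - 1⟩]) 0 (fun p q => rfl) (-1)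
    (fun n hn k => ?_) (fun n h => ?_) ?_
  · rw [mul_neg_one] at h
    refine h.congr' ?_
    filter_upwards [show H2 ∈ toBoundary from mem_inf_of_right (mem_principal_self _)] with W hW
    have hd : diagVec 1 1 = fun _ => (⟨1, 1⟩ : GaussianInt) := by
      funext j; fin_cases j <;> rfl
    have hs := (summable_norm_thetaSeries (fun n => (norm_latticeChar
      ((1 / 2 : ℂ) • gaussVec ![⟨1, 0⟩, ⟨0, 1⟩]) n).le)
        ((1 / 2 : ℂ) • gaussVec (diagVec 1 1)) hW).of_norm
    have hs' := (summable_norm_thetaSeries (fun n => (norm_latticeChar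
      ((1 / 2 : ℂ) • gaussVec ![⟨1, 0⟩, ⟨0, 1⟩]) (σ n)).le)
        ((1 / 2 : ℂ) • gaussVec (diagVec 1 1)) hW).of_norm
    have hrot := thetaSeries_rotation χ (fun _ => 1) W
    rw [← hd, ← hσ] at hrot
    congr 1
    rw [weightFourFactor, thetaChar_eq_thetaSeries, ← hχ]
    have h2 : thetaSeries (fun n => (χ n + χ (σ n)) / 2) ((1 / 2 : ℂ) • gaussVec (diagVec 1 1)) W =
        (thetaSeries χ ((1 / 2 : ℂ) • gaussVec (diagVec 1 1)) W +
          thetaSeries (fun n => χ (σ n)) ((1 / 2 : ℂ) • gaussVec (diagVec 1 1)) W) / 2 := by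
      rw [thetaSeries, thetaSeries, thetaSeries, ← hs.tsum_add hs', ← tsum_div_const]
      refine tsum_congr fun n => ?_
      ring
    rw [h2, hrot]
    ring
  · have ho := hparity n hn
    fin_cases k
    · exact hodd n
    · simpa [qExponent, diagVec] using two_le_sq_add_sq_of_odd (n 1).re (n 1).im
    · simp [qExponent, diagVec]
      have : (n 0).re + (n 1).re + 1 ≠ 0 ∨ (n 0).im + (n 1).im + 1 ≠ 0 := by
        by_contra hc
        push Not at hc
        obtain ⟨k, hk⟩ := ho
        omega
      rcases this with h | h
      · have := pow_pos (abs_pos.2 h) 2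
        rw [sq_abs] at this
        nlinarith [sq_nonneg ((n 0).im + (n 1).im + 1)]
      · have := pow_pos (abs_pos.2 h) 2
        rw [sq_abs] at this
        nlinarith [sq_nonneg ((n 0).re + (n 1).re + 1)]
    · exact two_le_qExponent_three n 1 1 (Or.inl (hodd n))
  · have h0 := congrFun h 0
    have h1 := congrFun h 1
    have h2 := congrFun h 2
    have h3 := congrFun h 3
    simp [qExponent, diagVec] at h0 h1 h2 h3
    obtain ⟨hp, hq⟩ := eq_of_sq_add_sq_eq_two h0
    refine ⟨hp, hq, fun _ => ?_⟩
    have hlin : (n 1).re = (n 0).im ∧ (n 1).im = -(n 0).re - 1 := by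
      rcases hp with hp | hp <;> rcases hq with hq | hq <;> rw [hp, hq] at h2 h3 ⊢ <;>
        constructor <;> nlinarith
    funext j
    fin_cases j
    · rfl
    · exact Zsqrtd.ext hlin.1 hlin.2
  · rintro p q hp hq
    constructor
    · funext k
      rcases hp with rfl | rfl <;> rcases hq with rfl | rfl <;> fin_cases k <;>
        simp [qExponent, diagVec]
    · rw [hχn, hσn]
      rcases hp with rfl | rfl <;> rcases hq with rfl | rfl <;> norm_num [zpow_neg]

/-! ### Asymptotics in terms of the square roots of the `Q`s. -/

/-- The square roots `exp (π i L / 2)` of `Q₁, Q₂, -Q₃, -Q₄`. -/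
def sqrtQ (W : Matrix (Fin 2) (Fin 2) ℂ) (k : Fin 4) : ℂ := cexp (Real.pi * I / 2 * logQ W k)

theorem sqrtQ_ne_zero (W : Matrix (Fin 2) (Fin 2) ℂ) (k : Fin 4) : sqrtQ W k ≠ 0 :=
  Complex.exp_ne_zero _

theorem tendsto_sqrtQ (k : Fin 4) : Tendsto (fun W => sqrtQ W k) toBoundary (𝓝 0) := by
  have h : ∀ W, ‖sqrtQ W k‖ = Real.exp (-(2 * (Real.pi / 4 * (logQ W k).im))) := fun W => by
    rw [sqrtQ, Complex.norm_exp]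
    congr 1
    simp
    ring
  rw [tendsto_zero_iff_norm_tendsto_zero]
  simp only [h]
  exact Real.tendsto_exp_atBot.comp (tendsto_neg_atTop_atBot.comp
    ((tendsto_im_logQ k).const_mul_atTop two_pos))

theorem qMonomial_eq (m : Fin 4 → ℕ) (W : Matrix (Fin 2) (Fin 2) ℂ) :
    qMonomial (fun k => 2 * (m k : ℤ)) W =
      sqrtQ W 0 ^ m 0 * sqrtQ W 1 ^ m 1 * sqrtQ W 2 ^ m 2 * sqrtQ W 3 ^ m 3 := by
  simp only [sqrtQ, ← Complex.exp_nat_mul, ← Complex.exp_add, qMonomial, Fin.sum_univ_four]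
  congr 1
  push_cast
  ring

theorem q_eq_sqrtQ (W : Matrix (Fin 2) (Fin 2) ℂ) :
    q W 0 = (sqrtQ W 0 * sqrtQ W 2 * sqrtQ W 3) ^ 2 ∧
      q W 1 = (sqrtQ W 1 * sqrtQ W 2 * sqrtQ W 3) ^ 2 ∧
      q W 2 = (sqrtQ W 2 * sqrtQ W 3) ^ 2 ∧ q W 3 = sqrtQ W 2 ^ 2 := by
  simp only [sqrtQ, ← Complex.exp_nat_mul, ← Complex.exp_add, q, logQ, Matrix.cons_val]
  refine ⟨?_, ?_, ?_, ?_⟩ <;>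
  · congr 1
    push_cast
    ring

/-- The product `Q₁ Q₂ Q₃ Q₄`. -/
def prodQ (W : Matrix (Fin 2) (Fin 2) ℂ) : ℂ :=
  (sqrtQ W 0 * sqrtQ W 1 * sqrtQ W 2 * sqrtQ W 3) ^ 2

theorem prodQ_ne_zero (W : Matrix (Fin 2) (Fin 2) ℂ) : prodQ W ≠ 0 :=
  pow_ne_zero 2 (mul_ne_zero (mul_ne_zero (mul_ne_zero (sqrtQ_ne_zero W 0) (sqrtQ_ne_zero W 1))
    (sqrtQ_ne_zero W 2)) (sqrtQ_ne_zero W 3))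

theorem tendsto_prodQ : Tendsto prodQ toBoundary (𝓝 0) := by
  unfold prodQ
  simpa using ((((tendsto_sqrtQ 0).mul (tendsto_sqrtQ 1)).mul (tendsto_sqrtQ 2)).mul
    (tendsto_sqrtQ 3)).pow 2

theorem tendsto_expansion_div_prodQ :
    Tendsto (fun W => (-64 * (q W 2 - q W 3) *
      (q W 0 * q W 1 * (1 - q W 2 * q W 3) / (q W 2 * q W 3))) / prodQ W) toBoundary (𝓝 64) := by
  have h : ∀ W, (-64 * (q W 2 - q W 3) *
      (q W 0 * q W 1 * (1 - q W 2 * q W 3) / (q W 2 * q W 3))) / prodQ W =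
      64 * (1 - sqrtQ W 3 ^ 2) * (1 - sqrtQ W 2 ^ 4 * sqrtQ W 3 ^ 2) := fun W => by
    obtain ⟨h0, h1, h2, h3⟩ := q_eq_sqrtQ W
    have n0 := sqrtQ_ne_zero W 0
    have n1 := sqrtQ_ne_zero W 1
    have n2 := sqrtQ_ne_zero W 2
    have n3 := sqrtQ_ne_zero W 3
    rw [h0, h1, h2, h3, prodQ]
    field_simp
    ring
  simp only [h]
  have := (((tendsto_sqrtQ 3).pow 2).const_sub 1 |>.const_mul 64).mul
    ((((tendsto_sqrtQ 2).pow 4).mul ((tendsto_sqrtQ 3).pow 2)).const_sub 1)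
  simpa using this

theorem tendsto_Theta_even {r : ℕ} (h0 : evenChar r 0 = 0) (h1 : evenChar r 1 = 0) :
    Tendsto (Theta r) toBoundary (𝓝 1) := by
  have h : ((1 + I) / 2) • ![evenChar r 0, evenChar r 1] = 0 := by
    funext j; fin_cases j <;> simp [h0, h1]
  have := tendsto_thetaChar_zero (((1 + I) / 2) • ![evenChar r 2, evenChar r 3])
  rw [← h] at this
  exact this

theorem tendsto_Theta_three : Tendsto (fun W => Theta 3 W / (sqrtQ W 0 * sqrtQ W 2 * sqrtQ W 3))
    toBoundary (𝓝 4) := by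
  refine (tendsto_thetaChar_one_zero 0).congr fun W => ?_
  rw [Theta_eq_thetaChar_diagVec ![1, 0, 0, 0] (by funext j; fin_cases j <;> simp [evenChar])]
  rw [show (![2, 0, 2, 2] : Fin 4 → ℤ) = fun k => 2 * ((![1, 0, 1, 1] k : ℕ) : ℤ) by
    funext k; fin_cases k <;> rfl, qMonomial_eq]
  simp

theorem tendsto_Theta_four : Tendsto (fun W => Theta 4 W / (sqrtQ W 0 * sqrtQ W 2 * sqrtQ W 3))
    toBoundary (𝓝 4) := by
  refine (tendsto_thetaChar_one_zero 1).congr fun W => ?_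
  rw [Theta_eq_thetaChar_diagVec ![1, 0, 0, 1] (by funext j; fin_cases j <;> simp [evenChar])]
  rw [show (![2, 0, 2, 2] : Fin 4 → ℤ) = fun k => 2 * ((![1, 0, 1, 1] k : ℕ) : ℤ) by
    funext k; fin_cases k <;> rfl, qMonomial_eq]
  simp

theorem tendsto_Theta_five : Tendsto (fun W => Theta 5 W / (sqrtQ W 1 * sqrtQ W 2 * sqrtQ W 3))
    toBoundary (𝓝 4) := by
  refine (tendsto_thetaChar_zero_one 0).congr fun W => ?_
  rw [Theta_eq_thetaChar_diagVec ![0, 1, 0, 0] (by funext j; fin_cases j <;> simp [evenChar])]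
  rw [show (![0, 2, 2, 2] : Fin 4 → ℤ) = fun k => 2 * ((![0, 1, 1, 1] k : ℕ) : ℤ) by
    funext k; fin_cases k <;> rfl, qMonomial_eq]
  simp

theorem tendsto_Theta_ten : Tendsto (fun W => Theta 10 W / (sqrtQ W 1 * sqrtQ W 2 * sqrtQ W 3))
    toBoundary (𝓝 4) := by
  refine (tendsto_thetaChar_zero_one 1).congr fun W => ?_
  rw [Theta_eq_thetaChar_diagVec ![0, 1, 1, 0] (by funext j; fin_cases j <;> simp [evenChar])]
  rw [show (![0, 2, 2, 2] : Fin 4 → ℤ) = fun k => 2 * ((![0, 1, 1, 1] k : ℕ) : ℤ) by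
    funext k; fin_cases k <;> rfl, qMonomial_eq]
  simp

theorem tendsto_thetaChar_one_one_div (β : Fin 2 → GaussianInt) (κ : ℂ)
    (hκ : ∀ p q, latticeChar ((1 / 2 : ℂ) • gaussVec β) ![⟨p, q⟩, ⟨-p - 1, -q - 1⟩] = κ) :
    Tendsto (fun W => thetaChar ((1 / 2 : ℂ) • gaussVec (diagVec 1 1))
      ((1 / 2 : ℂ) • gaussVec β) W / (sqrtQ W 0 * sqrtQ W 1 * sqrtQ W 3)) toBoundary
      (𝓝 (4 * κ)) := by
  refine (tendsto_thetaChar_one_one β κ hκ).congr fun W => ?_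
  rw [show (![2, 2, 0, 2] : Fin 4 → ℤ) = fun k => 2 * ((![1, 1, 0, 1] k : ℕ) : ℤ) by
    funext k; fin_cases k <;> rfl, qMonomial_eq]
  simp

theorem tendsto_Theta_one : Tendsto (fun W => Theta 1 W / (sqrtQ W 0 * sqrtQ W 1 * sqrtQ W 3))
    toBoundary (𝓝 4) := by
  rw [← mul_one (4 : ℂ)]
  refine (tendsto_thetaChar_one_one_div (diagVec 1 1) 1 fun p q => ?_).congr fun W => ?_
  · rw [latticeChar_half]
    refine Even.neg_one_zpow ⟨-1, ?_⟩
    simp [diagVec]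
    ring
  · rw [Theta_eq_thetaChar_diagVec ![1, 1, 1, 1] (by funext j; fin_cases j <;> simp [evenChar])]
    rfl

theorem tendsto_Theta_two : Tendsto (fun W => Theta 2 W / (sqrtQ W 0 * sqrtQ W 1 * sqrtQ W 3))
    toBoundary (𝓝 4) := by
  rw [← mul_one (4 : ℂ)]
  refine (tendsto_thetaChar_one_one_div (diagVec 0 0) 1 fun p q => ?_).congr fun W => ?_
  · rw [latticeChar_half]
    simp [diagVec]
  · rw [Theta_eq_thetaChar_diagVec ![1, 1, 0, 0] (by funext j; fin_cases j <;> simp [evenChar])]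
    rfl

theorem tendsto_Theta_three_sub_four :
    Tendsto (fun W => (Theta 3 W - Theta 4 W) / 2 /
      (sqrtQ W 0 * sqrtQ W 1 ^ 2 * sqrtQ W 2 * sqrtQ W 3)) toBoundary (𝓝 4) := by
  refine tendsto_thetaChar_sub.congr fun W => ?_
  rw [Theta_eq_thetaChar_diagVec ![1, 0, 0, 0] (by funext j; fin_cases j <;> simp [evenChar]),
    Theta_eq_thetaChar_diagVec ![1, 0, 0, 1] (by funext j; fin_cases j <;> simp [evenChar])]
  rw [show (![2, 4, 2, 2] : Fin 4 → ℤ) = fun k => 2 * ((![1, 2, 1, 1] k : ℕ) : ℤ) by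
    funext k; fin_cases k <;> rfl, qMonomial_eq]
  simp

theorem tendsto_weightFourProduct_div :
    Tendsto (fun W => weightFourProduct W / prodQ W) toBoundary (𝓝 16) := by
  have h0 : (1 / 2 : ℂ) • gaussVec (diagVec 0 0) = 0 := by
    funext j; fin_cases j <;> simp [gaussVec, diagVec] <;> rfl
  have f1 : Tendsto (weightFourFactor 0 ⟨1, 0⟩) toBoundary (𝓝 1) := by
    have := tendsto_thetaChar_zero ((1 / 2 : ℂ) • gaussVec ![⟨1, 0⟩, ⟨1, 0⟩])
    rwa [← h0] at this
  have f2 : Tendsto (weightFourFactor 0 ⟨0, 1⟩) toBoundary (𝓝 1) := by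
    have := tendsto_thetaChar_zero ((1 / 2 : ℂ) • gaussVec ![⟨1, 0⟩, ⟨0, 1⟩])
    rwa [← h0] at this
  have f3 := tendsto_thetaChar_one_one_div ![⟨1, 0⟩, ⟨1, 0⟩] (-1) fun p q => by
    rw [latticeChar_half]
    refine Odd.neg_one_zpow ⟨-1, ?_⟩
    simp
    ring
  have h := ((f1.mul f2).mul f3).mul tendsto_weightFourFactor_one_I
  norm_num at h
  refine h.congr fun W => ?_
  have n0 := sqrtQ_ne_zero W 0
  have n1 := sqrtQ_ne_zero W 1
  have n2 := sqrtQ_ne_zero W 2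
  have n3 := sqrtQ_ne_zero W 3
  rw [show (![2, 2, 4, 2] : Fin 4 → ℤ) = fun k => 2 * ((![1, 1, 2, 1] k : ℕ) : ℤ) by
    funext k; fin_cases k <;> rfl, qMonomial_eq, weightFourProduct, prodQ]
  simp only [weightFourFactor, Matrix.cons_val]
  field_simp

theorem isWeightFourTheta_weightFourProduct :
    IsWeightFourTheta fun W => 15 * weightFourProduct W where
  holomorphic := by
    simp only [weightFourProduct, weightFourFactor]
    exact ((((differentiableOn_thetaChar _ _).mul (differentiableOn_thetaChar _ _)).mul
      (differentiableOn_thetaChar _ _)).mul (differentiableOn_thetaChar _ _)).const_mul 15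
  sq_eq W hW := by
    have h1 := weightFourProduct_sq hW
    rw [(linearRelations hW).discriminant_eq] at h1
    linear_combination 225 / 16 * h1
  expansion := by
    -- The factor 4 is 4 / 15 times 15, and 4 · 16 / 64 = 1 fixes the sign of the product.
    have h := (tendsto_weightFourProduct_div.const_mul 4).div tendsto_expansion_div_prodQ
      (by norm_num)
    norm_num at h
    refine h.congr fun W => ?_
    have := prodQ_ne_zero W
    simp only [Pi.div_apply]
    rw [← mul_div_assoc, div_div_div_cancel_right₀ this]
    congr 1 <;> ring

/-! ### Asymptotics of the five parameters. -/

theorem H2_mem_toBoundary : H2 ∈ toBoundary := mem_inf_of_right (mem_principal_self _)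

theorem tendsto_paramA : Tendsto paramA toBoundary (𝓝 1) := by
  have h : ∀ r, evenChar r 0 = 0 → evenChar r 1 = 0 →
      Tendsto (fun W => Theta r W ^ 2) toBoundary (𝓝 (1 ^ 2)) := fun r h0 h1 =>
    (tendsto_Theta_even h0 h1).pow 2
  have h' := ((((h 6 rfl rfl).add (h 7 rfl rfl)).add (h 8 rfl rfl)).add (h 9 rfl rfl)).div_const 4
  norm_num at h'
  refine h'.congr' ?_
  filter_upwards [H2_mem_toBoundary] with W hW
  have hl := linearRelations hW
  rw [hl.eq6, hl.eq7, hl.eq8, hl.eq9]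
  ring

theorem tendsto_paramB :
    Tendsto (fun W => paramB W / (sqrtQ W 1 * sqrtQ W 2 * sqrtQ W 3) ^ 2) toBoundary (𝓝 8) := by
  have h := ((tendsto_Theta_five.pow 2).add (tendsto_Theta_ten.pow 2)).div_const 4
  norm_num at h
  refine h.congr' ?_
  filter_upwards [H2_mem_toBoundary] with W hW
  have hl := linearRelations hW
  rw [div_pow, div_pow, ← add_div, hl.eq5, hl.eq10, div_right_comm]
  congr 1
  ring

theorem tendsto_paramC :
    Tendsto (fun W => paramC W / (sqrtQ W 0 * sqrtQ W 2 * sqrtQ W 3) ^ 2) toBoundary (𝓝 8) := by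
  have h := ((tendsto_Theta_three.pow 2).add (tendsto_Theta_four.pow 2)).div_const 4
  norm_num at h
  refine h.congr' ?_
  filter_upwards [H2_mem_toBoundary] with W hW
  have hl := linearRelations hW
  rw [div_pow, div_pow, ← add_div, hl.eq3, hl.eq4, div_right_comm]
  congr 1
  ring

theorem tendsto_paramD :
    Tendsto (fun W => paramD W / (sqrtQ W 0 * sqrtQ W 1 * sqrtQ W 3) ^ 2) toBoundary (𝓝 8) := by
  have h := ((tendsto_Theta_one.pow 2).add (tendsto_Theta_two.pow 2)).div_const 4
  norm_num at h
  refine h.congr' ?_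
  filter_upwards [H2_mem_toBoundary] with W hW
  have hl := linearRelations hW
  rw [div_pow, div_pow, ← add_div, hl.eq1, hl.eq2, div_right_comm]
  congr 1
  ring

/-- Four times `paramE` is Θ₃² - Θ₄², where the leading terms cancel; the limit comes from the
factorisation into difference and sum. -/
theorem tendsto_paramE : Tendsto (fun W => paramE W / prodQ W) toBoundary (𝓝 16) := by
  have h := tendsto_Theta_three_sub_four.mul
    ((tendsto_Theta_three.add tendsto_Theta_four).div_const 2)
  norm_num at h
  refine h.congr' ?_
  filter_upwards [H2_mem_toBoundary] with W hW
  have hl := linearRelations hW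
  have e : paramE W = (Theta 3 W - Theta 4 W) * (Theta 3 W + Theta 4 W) / 4 := by
    linear_combination (hl.eq4 - hl.eq3) / 4
  have n0 := sqrtQ_ne_zero W 0
  have n1 := sqrtQ_ne_zero W 1
  have n2 := sqrtQ_ne_zero W 2
  have n3 := sqrtQ_ne_zero W 3
  rw [e, prodQ]
  field_simp
  ring

/-! ### The two roots and their behaviour at the boundary point. -/

variable {Θt : Matrix (Fin 2) (Fin 2) ℂ → ℂ}

theorem IsWeightFourTheta.tendsto_thetaTilde (h : IsWeightFourTheta Θt) :
    Tendsto (fun W => thetaTilde Θt W / prodQ W) toBoundary (𝓝 64) := by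
  have h1 := h.expansion.mul tendsto_expansion_div_prodQ
  rw [one_mul] at h1
  refine h1.congr' ?_
  filter_upwards [tendsto_expansion_div_prodQ.eventually_ne (by norm_num : (64 : ℂ) ≠ 0)] with W hW
  exact div_mul_div_cancel₀ (div_ne_zero_iff.1 hW).1

theorem IsWeightFourTheta.discriminant_eq (h : IsWeightFourTheta Θt)
    {W : Matrix (Fin 2) (Fin 2) ℂ} (hW : W ∈ H2) :
    T W ^ 2 - 4 * Theta 6 W ^ 2 * Theta 7 W ^ 2 * Theta 8 W ^ 2 * Theta 9 W ^ 2 =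
      2 ^ 4 / (3 ^ 2 * 5 ^ 2) * Θt W ^ 2 := by
  rw [(linearRelations hW).discriminant_eq, h.sq_eq W hW]
  ring

theorem IsWeightFourTheta.masterEquation_iff (h : IsWeightFourTheta Θt)
    {W : Matrix (Fin 2) (Fin 2) ℂ} (hW : W ∈ H2) (h8 : Theta 8 W ≠ 0) {z : Fin 4 → ℂ}
    (hz : ∀ k, z k ≠ 0) (w : ℂ) :
    MasterEquation W z w ↔ z = zTheta W w ∧
      (w = (T W - thetaTilde Θt W) / (2 * Theta 8 W ^ 2) ∨
        w = (T W + thetaTilde Θt W) / (2 * Theta 8 W ^ 2)) := by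
  rw [(linearRelations hW).masterEquation_iff h8 hz]
  refine and_congr_right fun _ => ?_
  have hd := h.discriminant_eq hW
  have h2 : 2 * Theta 8 W ^ 2 ≠ 0 := mul_ne_zero two_ne_zero (pow_ne_zero 2 h8)
  rw [eq_div_iff h2, eq_div_iff h2]
  constructor
  · intro hq
    have : (w * (2 * Theta 8 W ^ 2) - (T W - thetaTilde Θt W)) *
        (w * (2 * Theta 8 W ^ 2) - (T W + thetaTilde Θt W)) = 0 := by
      rw [thetaTilde]
      linear_combination 4 * Theta 8 W ^ 2 * hq + hd
    rcases mul_eq_zero.1 this with h' | h'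
    · exact Or.inl (sub_eq_zero.1 h')
    · exact Or.inr (sub_eq_zero.1 h')
  · intro hw
    have : (w * (2 * Theta 8 W ^ 2) - (T W - thetaTilde Θt W)) *
        (w * (2 * Theta 8 W ^ 2) - (T W + thetaTilde Θt W)) = 0 := by
      rcases hw with h' | h' <;> rw [h'] <;> ring
    have h3 : (4 * Theta 8 W ^ 2) * (Theta 8 W ^ 2 * w ^ 2 - T W * w +
        Theta 6 W ^ 2 * Theta 7 W ^ 2 * Theta 9 W ^ 2) = 0 := by
      rw [thetaTilde] at this
      linear_combination this - hd
    exact (mul_eq_zero.1 h3).resolve_left (mul_ne_zero four_ne_zero (pow_ne_zero 2 h8))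

/-- The other root of the quadratic equation for `ω₀²`. -/
def omegaSqConj (Θt : Matrix (Fin 2) (Fin 2) ℂ → ℂ) (W : Matrix (Fin 2) (Fin 2) ℂ) : ℂ :=
  (T W + thetaTilde Θt W) / (2 * Theta 8 W ^ 2)

theorem tendsto_Theta_eight_sq : Tendsto (fun W => Theta 8 W ^ 2) toBoundary (𝓝 1) := by
  simpa using (tendsto_Theta_even (r := 8) rfl rfl).pow 2

theorem eventually_Theta_eight_ne_zero : ∀ᶠ W in toBoundary, Theta 8 W ≠ 0 :=
  (tendsto_Theta_even (r := 8) rfl rfl).eventually_ne one_ne_zero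

theorem tendsto_quadratic_params :
    Tendsto (fun W => 2 * (paramB W * paramD W + paramC W * paramD W - paramB W * paramC W
      - paramE W ^ 2) / prodQ W) toBoundary (𝓝 0) := by
  have s0 := tendsto_sqrtQ 0
  have s1 := tendsto_sqrtQ 1
  have s2 := tendsto_sqrtQ 2
  have s3 := tendsto_sqrtQ 3
  have h := ((((tendsto_paramB.mul tendsto_paramD).mul ((s1.mul s3).pow 2)).add
    ((tendsto_paramC.mul tendsto_paramD).mul ((s0.mul s3).pow 2))).sub
    ((tendsto_paramB.mul tendsto_paramC).mul ((s2.mul s3).pow 2))).sub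
    ((tendsto_paramE.pow 2).mul tendsto_prodQ) |>.const_mul 2
  norm_num at h
  refine h.congr fun W => ?_
  have n0 := sqrtQ_ne_zero W 0
  have n1 := sqrtQ_ne_zero W 1
  have n2 := sqrtQ_ne_zero W 2
  have n3 := sqrtQ_ne_zero W 3
  rw [prodQ]
  field_simp

/-- Multiplied by `Θ₈²`, the numerator is 2 E Θ₈² + Θ̃ / 2 plus the terms of
`tendsto_quadratic_params`, with E = `paramE`. The two main terms contribute 32 each. -/
theorem IsWeightFourTheta.tendsto_numerator_three (h : IsWeightFourTheta Θt) :
    Tendsto (fun W => (Theta 3 W ^ 2 + Theta 9 W ^ 2 - omegaSq Θt W) / prodQ W) toBoundary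
      (𝓝 64) := by
  have hk := ((tendsto_quadratic_params.add ((tendsto_paramE.mul tendsto_Theta_eight_sq).const_mul
    2)).add (h.tendsto_thetaTilde.div_const 2)).div tendsto_Theta_eight_sq one_ne_zero
  norm_num at hk
  refine hk.congr' ?_
  filter_upwards [H2_mem_toBoundary, eventually_Theta_eight_ne_zero] with W hW h8
  have hl := linearRelations hW
  have hp := prodQ_ne_zero W
  have h82 : Theta 8 W ^ 2 ≠ 0 := pow_ne_zero 2 h8
  simp only [Pi.div_apply]
  rw [omegaSq, hl.T_eq, hl.eq3, hl.eq9]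
  have h8e := hl.eq8
  rw [div_eq_div_iff h82 hp]
  field_simp
  rw [h8e]
  ring

/-- Here both main terms change sign, so the limit is -32 - 32. In the two mixed cases they cancel,
and the product formulas `numerator_four_mul_conj` and `numerator_three_mul_conj` are used instead.
-/
theorem IsWeightFourTheta.tendsto_numerator_four_conj (h : IsWeightFourTheta Θt) :
    Tendsto (fun W => (Theta 4 W ^ 2 + Theta 9 W ^ 2 - omegaSqConj Θt W) / prodQ W) toBoundary
      (𝓝 (-64)) := by
  have hk := ((tendsto_quadratic_params.sub ((tendsto_paramE.mul tendsto_Theta_eight_sq).const_mul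
    2)).sub (h.tendsto_thetaTilde.div_const 2)).div tendsto_Theta_eight_sq one_ne_zero
  norm_num at hk
  refine hk.congr' ?_
  filter_upwards [H2_mem_toBoundary, eventually_Theta_eight_ne_zero] with W hW h8
  have hl := linearRelations hW
  have hp := prodQ_ne_zero W
  have h82 : Theta 8 W ^ 2 ≠ 0 := pow_ne_zero 2 h8
  simp only [Pi.div_apply]
  rw [omegaSqConj, hl.T_eq, hl.eq4, hl.eq9]
  have h8e := hl.eq8
  rw [div_eq_div_iff h82 hp]
  field_simp
  rw [h8e]
  ring

theorem eventually_ne_zero_of_tendsto_div {f g : Matrix (Fin 2) (Fin 2) ℂ → ℂ} {c : ℂ}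
    (h : Tendsto (fun W => f W / g W) toBoundary (𝓝 c)) (hc : c ≠ 0) :
    ∀ᶠ W in toBoundary, f W ≠ 0 :=
  (h.eventually_ne hc).mono fun _ hW => (div_ne_zero_iff.1 hW).1

/-- The quadratic polynomial with the roots `omegaSq` and `omegaSqConj`. -/
theorem IsWeightFourTheta.mul_sub_omegaSq (h : IsWeightFourTheta Θt)
    {W : Matrix (Fin 2) (Fin 2) ℂ} (hW : W ∈ H2) (h8 : Theta 8 W ≠ 0) (w : ℂ) :
    Theta 8 W ^ 2 * (w - omegaSq Θt W) * (w - omegaSqConj Θt W) =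
      (Theta 3 W ^ 2 + Theta 9 W ^ 2 - w) * (Theta 4 W ^ 2 + Theta 9 W ^ 2 - w) * w
      - (w - Theta 6 W ^ 2) * (w - Theta 7 W ^ 2) * (w - Theta 9 W ^ 2) := by
  have hd := h.discriminant_eq hW
  rw [(linearRelations hW).cubic_eq, omegaSq, omegaSqConj, thetaTilde]
  field_simp
  linear_combination 225 * hd

/-- This is the quadratic polynomial at w = Θ₃² + Θ₉². There the first product in the cubic identity
vanishes, and the linear relations turn the remaining factors into theta squares up to sign. -/
theorem IsWeightFourTheta.numerator_three_mul_conj (h : IsWeightFourTheta Θt)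
    {W : Matrix (Fin 2) (Fin 2) ℂ} (hW : W ∈ H2) (h8 : Theta 8 W ≠ 0) :
    Theta 8 W ^ 2 * (Theta 3 W ^ 2 + Theta 9 W ^ 2 - omegaSq Θt W) *
        (Theta 3 W ^ 2 + Theta 9 W ^ 2 - omegaSqConj Θt W) =
      Theta 1 W ^ 2 * Theta 5 W ^ 2 * Theta 3 W ^ 2 := by
  have hl := linearRelations hW
  rw [h.mul_sub_omegaSq hW h8, hl.eq1, hl.eq5, hl.eq3, hl.eq6, hl.eq7, hl.eq9]
  ring

theorem IsWeightFourTheta.numerator_four_mul_conj (h : IsWeightFourTheta Θt)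
    {W : Matrix (Fin 2) (Fin 2) ℂ} (hW : W ∈ H2) (h8 : Theta 8 W ≠ 0) :
    Theta 8 W ^ 2 * (Theta 4 W ^ 2 + Theta 9 W ^ 2 - omegaSq Θt W) *
        (Theta 4 W ^ 2 + Theta 9 W ^ 2 - omegaSqConj Θt W) =
      Theta 2 W ^ 2 * Theta 10 W ^ 2 * Theta 4 W ^ 2 := by
  have hl := linearRelations hW
  rw [h.mul_sub_omegaSq hW h8, hl.eq2, hl.eq10, hl.eq4, hl.eq6, hl.eq7, hl.eq9]
  ring

theorem IsWeightFourTheta.tendsto_numerator_four (h : IsWeightFourTheta Θt) :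
    Tendsto (fun W => (Theta 4 W ^ 2 + Theta 9 W ^ 2 - omegaSq Θt W) /
      (prodQ W * sqrtQ W 3 ^ 2)) toBoundary (𝓝 (-64)) := by
  have hk := ((tendsto_Theta_two.pow 2).mul (tendsto_Theta_ten.pow 2)).mul
    (tendsto_Theta_four.pow 2) |>.div
    (tendsto_Theta_eight_sq.mul h.tendsto_numerator_four_conj) (by norm_num)
  norm_num at hk
  refine hk.congr' ?_
  filter_upwards [H2_mem_toBoundary, eventually_Theta_eight_ne_zero,
    eventually_ne_zero_of_tendsto_div h.tendsto_numerator_four_conj (by norm_num)] with W hW h8 h4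
  have hm := h.numerator_four_mul_conj hW h8
  have n0 := sqrtQ_ne_zero W 0
  have n1 := sqrtQ_ne_zero W 1
  have n2 := sqrtQ_ne_zero W 2
  have n3 := sqrtQ_ne_zero W 3
  simp only [Pi.div_apply, div_pow]
  rw [div_mul_div_comm, div_mul_div_comm, ← hm, prodQ]
  field_simp

theorem IsWeightFourTheta.tendsto_numerator_three_conj (h : IsWeightFourTheta Θt) :
    Tendsto (fun W => (Theta 3 W ^ 2 + Theta 9 W ^ 2 - omegaSqConj Θt W) /
      (prodQ W * sqrtQ W 3 ^ 2)) toBoundary (𝓝 64) := by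
  have hk := ((tendsto_Theta_one.pow 2).mul (tendsto_Theta_five.pow 2)).mul
    (tendsto_Theta_three.pow 2) |>.div
    (tendsto_Theta_eight_sq.mul h.tendsto_numerator_three) (by norm_num)
  norm_num at hk
  refine hk.congr' ?_
  filter_upwards [H2_mem_toBoundary, eventually_Theta_eight_ne_zero,
    eventually_ne_zero_of_tendsto_div h.tendsto_numerator_three (by norm_num)] with W hW h8 h3
  have hm := h.numerator_three_mul_conj hW h8
  have n0 := sqrtQ_ne_zero W 0
  have n1 := sqrtQ_ne_zero W 1
  have n2 := sqrtQ_ne_zero W 2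
  have n3 := sqrtQ_ne_zero W 3
  simp only [Pi.div_apply, div_pow]
  rw [div_mul_div_comm, div_mul_div_comm, ← hm, prodQ]
  field_simp

theorem IsWeightFourTheta.tendsto_omegaSq (h : IsWeightFourTheta Θt) :
    Tendsto (omegaSq Θt) toBoundary (𝓝 1) := by
  have h3 : Tendsto (fun W => Theta 3 W ^ 2) toBoundary (𝓝 0) := by
    have := ((tendsto_Theta_three.mul
      (((tendsto_sqrtQ 0).mul (tendsto_sqrtQ 2)).mul (tendsto_sqrtQ 3)))).pow 2
    norm_num at this
    refine this.congr fun W => ?_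
    rw [div_mul_cancel₀]
    exact mul_ne_zero (mul_ne_zero (sqrtQ_ne_zero W 0) (sqrtQ_ne_zero W 2)) (sqrtQ_ne_zero W 3)
  have h9 : Tendsto (fun W => Theta 9 W ^ 2) toBoundary (𝓝 1) := by
    simpa using (tendsto_Theta_even (r := 9) rfl rfl).pow 2
  have hk := (h3.add h9).sub (h.tendsto_numerator_three.mul tendsto_prodQ)
  norm_num at hk
  refine hk.congr fun W => ?_
  rw [div_mul_cancel₀ _ (prodQ_ne_zero W)]
  ring

theorem IsWeightFourTheta.tendsto_sub_seven (h : IsWeightFourTheta Θt) :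
    Tendsto (fun W => (omegaSq Θt W - Theta 7 W ^ 2) /
      (sqrtQ W 1 * sqrtQ W 2 * sqrtQ W 3) ^ 2) toBoundary (𝓝 16) := by
  have s0 := tendsto_sqrtQ 0
  have s1 := tendsto_sqrtQ 1
  have s2 := tendsto_sqrtQ 2
  have s3 := tendsto_sqrtQ 3
  have hb := tendsto_paramB.mul (((s1.mul s2).mul s3).pow 2)
  have hk := ((((tendsto_paramB.mul (tendsto_paramA.sub hb)).sub
    ((tendsto_paramC.mul tendsto_paramD).mul ((s0.pow 4).mul (s3.pow 2)))).add
    ((tendsto_paramE.pow 2).mul (tendsto_prodQ.mul (s0.pow 2)))).const_mul 2).sub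
    ((h.tendsto_thetaTilde.mul (s0.pow 2)).div_const 2) |>.div tendsto_Theta_eight_sq one_ne_zero
  norm_num at hk
  refine hk.congr' ?_
  filter_upwards [H2_mem_toBoundary, eventually_Theta_eight_ne_zero] with W hW h8
  have hl := linearRelations hW
  have h82 : Theta 8 W ^ 2 ≠ 0 := pow_ne_zero 2 h8
  have n0 := sqrtQ_ne_zero W 0
  have n1 := sqrtQ_ne_zero W 1
  have n2 := sqrtQ_ne_zero W 2
  have n3 := sqrtQ_ne_zero W 3
  simp only [Pi.div_apply]
  have e : omegaSq Θt W - Theta 7 W ^ 2 = (2 * (paramB W * (paramA W - paramB W)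
      - paramC W * paramD W + paramE W ^ 2) - thetaTilde Θt W / 2) / Theta 8 W ^ 2 := by
    have h8e := hl.eq8
    rw [omegaSq, hl.T_eq, hl.eq7]
    field_simp
    rw [h8e]
    ring
  rw [e, prodQ]
  field_simp

theorem IsWeightFourTheta.tendsto_sub_nine (h : IsWeightFourTheta Θt) :
    Tendsto (fun W => (omegaSq Θt W - Theta 9 W ^ 2) /
      (sqrtQ W 0 * sqrtQ W 2 * sqrtQ W 3) ^ 2) toBoundary (𝓝 16) := by
  have s0 := tendsto_sqrtQ 0
  have s1 := tendsto_sqrtQ 1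
  have s2 := tendsto_sqrtQ 2
  have s3 := tendsto_sqrtQ 3
  have hb := tendsto_paramC.mul (((s0.mul s2).mul s3).pow 2)
  have hk := ((((tendsto_paramC.mul (tendsto_paramA.sub hb)).sub
    ((tendsto_paramB.mul tendsto_paramD).mul ((s1.pow 4).mul (s3.pow 2)))).add
    ((tendsto_paramE.pow 2).mul (tendsto_prodQ.mul (s1.pow 2)))).const_mul 2).sub
    ((h.tendsto_thetaTilde.mul (s1.pow 2)).div_const 2) |>.div tendsto_Theta_eight_sq one_ne_zero
  norm_num at hk
  refine hk.congr' ?_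
  filter_upwards [H2_mem_toBoundary, eventually_Theta_eight_ne_zero] with W hW h8
  have hl := linearRelations hW
  have h82 : Theta 8 W ^ 2 ≠ 0 := pow_ne_zero 2 h8
  have n0 := sqrtQ_ne_zero W 0
  have n1 := sqrtQ_ne_zero W 1
  have n2 := sqrtQ_ne_zero W 2
  have n3 := sqrtQ_ne_zero W 3
  simp only [Pi.div_apply]
  have e : omegaSq Θt W - Theta 9 W ^ 2 = (2 * (paramC W * (paramA W - paramC W)
      - paramB W * paramD W + paramE W ^ 2) - thetaTilde Θt W / 2) / Theta 8 W ^ 2 := by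
    have h8e := hl.eq8
    rw [omegaSq, hl.T_eq, hl.eq9]
    field_simp
    rw [h8e]
    ring
  rw [e, prodQ]
  field_simp

theorem IsWeightFourTheta.eventually_zTheta_ne_zero (h : IsWeightFourTheta Θt) :
    ∀ᶠ W in toBoundary, ∀ k, zTheta W (omegaSq Θt W) k ≠ 0 := by
  filter_upwards [eventually_ne_zero_of_tendsto_div h.tendsto_numerator_three (by norm_num),
    eventually_ne_zero_of_tendsto_div h.tendsto_numerator_four (by norm_num),
    eventually_ne_zero_of_tendsto_div h.tendsto_sub_seven (by norm_num),
    eventually_ne_zero_of_tendsto_div h.tendsto_sub_nine (by norm_num),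
    h.tendsto_omegaSq.eventually_ne one_ne_zero] with W h3 h4 h7 h9 hw
  intro k
  fin_cases k
  · exact div_ne_zero h3 h7
  · exact div_ne_zero h3 h9
  · exact div_ne_zero (mul_ne_zero h7 h9) (mul_ne_zero hw h4)
  · exact div_ne_zero h4 h3

/-- The quotients of leading terms give z ~ (4 Q₁, 4 Q₂, 4 Q₃, Q₄). -/
theorem IsWeightFourTheta.tendsto_zTheta (h : IsWeightFourTheta Θt) :
    Tendsto (fun W => zTheta W (omegaSq Θt W)) toBoundary (𝓝 0) := by
  rw [tendsto_pi_nhds]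
  intro k
  fin_cases k
  · have hk := (h.tendsto_numerator_three.div h.tendsto_sub_seven (by norm_num)).mul
      ((tendsto_sqrtQ 0).pow 2)
    norm_num at hk
    refine hk.congr' ?_
    filter_upwards [eventually_ne_zero_of_tendsto_div h.tendsto_sub_seven (by norm_num)] with W h7
    have n0 := sqrtQ_ne_zero W 0
    have n1 := sqrtQ_ne_zero W 1
    have n2 := sqrtQ_ne_zero W 2
    have n3 := sqrtQ_ne_zero W 3
    simp only [zTheta, prodQ, Fin.zero_eta, Matrix.cons_val]
    field_simp
  · have hk := (h.tendsto_numerator_three.div h.tendsto_sub_nine (by norm_num)).mul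
      ((tendsto_sqrtQ 1).pow 2)
    norm_num at hk
    refine hk.congr' ?_
    filter_upwards [eventually_ne_zero_of_tendsto_div h.tendsto_sub_nine (by norm_num)] with W h9
    have n0 := sqrtQ_ne_zero W 0
    have n1 := sqrtQ_ne_zero W 1
    have n2 := sqrtQ_ne_zero W 2
    have n3 := sqrtQ_ne_zero W 3
    simp only [zTheta, prodQ, Fin.mk_one, Matrix.cons_val]
    field_simp
  · have hk := ((h.tendsto_sub_seven.mul h.tendsto_sub_nine).div
      (h.tendsto_omegaSq.mul h.tendsto_numerator_four) (by norm_num)).mul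
      ((tendsto_sqrtQ 2).pow 2)
    norm_num at hk
    refine hk.congr' ?_
    filter_upwards [eventually_ne_zero_of_tendsto_div h.tendsto_numerator_four (by norm_num),
      h.tendsto_omegaSq.eventually_ne one_ne_zero] with W h4 hw
    have n0 := sqrtQ_ne_zero W 0
    have n1 := sqrtQ_ne_zero W 1
    have n2 := sqrtQ_ne_zero W 2
    have n3 := sqrtQ_ne_zero W 3
    simp only [zTheta, prodQ, Fin.reduceFinMk, Matrix.cons_val]
    field_simp
  · have hk := (h.tendsto_numerator_four.div h.tendsto_numerator_three (by norm_num)).mul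
      ((tendsto_sqrtQ 3).pow 2)
    norm_num at hk
    refine hk.congr' ?_
    filter_upwards [eventually_ne_zero_of_tendsto_div h.tendsto_numerator_three (by norm_num)]
      with W h3
    have n0 := sqrtQ_ne_zero W 0
    have n1 := sqrtQ_ne_zero W 1
    have n2 := sqrtQ_ne_zero W 2
    have n3 := sqrtQ_ne_zero W 3
    simp only [zTheta, prodQ, Fin.reduceFinMk, Matrix.cons_val]
    field_simp

/-- For the other root the orders of the two numerators in z₄ are exchanged, so 1 / z₄ ~ Q₄ tends to
0. -/
theorem IsWeightFourTheta.eventually_le_norm_zTheta_conj (h : IsWeightFourTheta Θt) (R : ℝ) :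
    ∀ᶠ W in toBoundary, R ≤ ‖zTheta W (omegaSqConj Θt W) 3‖ := by
  have hk := (h.tendsto_numerator_three_conj.div h.tendsto_numerator_four_conj (by norm_num)).mul
    ((tendsto_sqrtQ 3).pow 2)
  norm_num at hk
  have hR : 0 < |R| + 1 := by positivity
  have hsmall := hk.norm.eventually_lt_const (u := (|R| + 1)⁻¹) (by simpa using by positivity)
  filter_upwards [hsmall,
    eventually_ne_zero_of_tendsto_div h.tendsto_numerator_four_conj (by norm_num),
    eventually_ne_zero_of_tendsto_div h.tendsto_numerator_three_conj (by norm_num)] with W hW h4 h3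
  have n3 := sqrtQ_ne_zero W 3
  have hp := prodQ_ne_zero W
  have e : (Theta 3 W ^ 2 + Theta 9 W ^ 2 - omegaSqConj Θt W) / (prodQ W * sqrtQ W 3 ^ 2) /
      ((Theta 4 W ^ 2 + Theta 9 W ^ 2 - omegaSqConj Θt W) / prodQ W) * sqrtQ W 3 ^ 2 =
      (zTheta W (omegaSqConj Θt W) 3)⁻¹ := by
    simp only [zTheta, Matrix.cons_val]
    field_simp
  rw [e, norm_inv] at hW
  have hz : zTheta W (omegaSqConj Θt W) 3 ≠ 0 := div_ne_zero h4 h3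
  have := (inv_lt_inv₀ (norm_pos_iff.2 hz) hR).1 hW
  linarith [le_abs_self R]

/-- Removes the assumption z ≠ 0 from the uniqueness claim: Θ₃² and Θ₁₀² do not vanish near `o₁`,
and P₇ and P₄ together contain every zₖ as a factor. -/
theorem eventually_ne_zero_of_masterEquation :
    ∀ᶠ W in toBoundary, ∀ z w, MasterEquation W z w → ∀ k, z k ≠ 0 := by
  filter_upwards [eventually_ne_zero_of_tendsto_div tendsto_Theta_three four_ne_zero,
    eventually_ne_zero_of_tendsto_div tendsto_Theta_ten four_ne_zero] with W h3 h10 z w hm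
  have h3' := pow_ne_zero 2 h3
  have h10' := pow_ne_zero 2 h10
  rw [masterEquation_iff_forall] at hm
  obtain ⟨-, -, -, m10, -, -, m3, -, -, -⟩ := hm
  simp only [P] at m10 m3
  rw [← m3] at h3'
  rw [← neg_ne_zero, ← m10] at h10'
  simp only [ne_eq, mul_eq_zero, neg_eq_zero, not_or] at h3' h10'
  intro k
  fin_cases k
  · exact h3'.1.1.1.1
  · exact h10'.1.1.1.2
  · exact h3'.1.1.2
  · exact h3'.1.2

end

end K3Lambda


theorem mainTheorem2 :
    (∃ Θt : Matrix (Fin 2) (Fin 2) ℂ → ℂ, K3Lambda.IsWeightFourTheta Θt) ∧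
    ∀ Θt : Matrix (Fin 2) (Fin 2) ℂ → ℂ, K3Lambda.IsWeightFourTheta Θt →
      (∀ W ∈ K3Lambda.H2,
        K3Lambda.T W ^ 2 - 4 * K3Lambda.Theta 6 W ^ 2 * K3Lambda.Theta 7 W ^ 2
            * K3Lambda.Theta 8 W ^ 2 * K3Lambda.Theta 9 W ^ 2
          = 2 ^ 4 / (3 ^ 2 * 5 ^ 2) * Θt W ^ 2) ∧
      (∀ W ∈ K3Lambda.H2, K3Lambda.Theta 8 W ≠ 0 →
        ∀ (z : Fin 4 → ℂ) (w : ℂ), (∀ k, z k ≠ 0) →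
          (K3Lambda.MasterEquation W z w ↔
            z = K3Lambda.zTheta W w ∧
              (w = (K3Lambda.T W - K3Lambda.thetaTilde Θt W) / (2 * K3Lambda.Theta 8 W ^ 2) ∨
                w = (K3Lambda.T W + K3Lambda.thetaTilde Θt W)
                  / (2 * K3Lambda.Theta 8 W ^ 2)))) ∧
      (∀ᶠ W in K3Lambda.toBoundary, K3Lambda.Theta 8 W ≠ 0 ∧
        (∀ k, K3Lambda.zTheta W (K3Lambda.omegaSq Θt W) k ≠ 0) ∧
        K3Lambda.MasterEquation W (K3Lambda.zTheta W (K3Lambda.omegaSq Θt W))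
          (K3Lambda.omegaSq Θt W)) ∧
      Tendsto (fun W => K3Lambda.zTheta W (K3Lambda.omegaSq Θt W)) K3Lambda.toBoundary (𝓝 0) ∧
      (∀ R : ℝ, ∀ᶠ W in K3Lambda.toBoundary, ∀ (z : Fin 4 → ℂ) (w : ℂ), (∀ k, ‖z k‖ < R) →
        K3Lambda.MasterEquation W z w →
          w = K3Lambda.omegaSq Θt W ∧ z = K3Lambda.zTheta W (K3Lambda.omegaSq Θt W)) := by
  refine ⟨⟨_, K3Lambda.isWeightFourTheta_weightFourProduct⟩, fun Θt h => ⟨fun W hW =>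
    h.discriminant_eq hW, fun W hW h8 z w hz => h.masterEquation_iff hW h8 hz w, ?_,
    h.tendsto_zTheta, fun R => ?_⟩⟩
  · filter_upwards [K3Lambda.H2_mem_toBoundary, K3Lambda.eventually_Theta_eight_ne_zero,
      h.eventually_zTheta_ne_zero] with W hW h8 hz
    exact ⟨h8, hz, (h.masterEquation_iff hW h8 hz _).2 ⟨rfl, Or.inl rfl⟩⟩
  · filter_upwards [K3Lambda.H2_mem_toBoundary, K3Lambda.eventually_Theta_eight_ne_zero,
      K3Lambda.eventually_ne_zero_of_masterEquation, h.eventually_le_norm_zTheta_conj R]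
      with W hW h8 hne hconj z w hR hm
    obtain ⟨hz, hw | hw⟩ := (h.masterEquation_iff hW h8 (hne z w hm) w).1 hm
    · exact ⟨hw, by rw [hz, hw]; rfl⟩
    -- The other root is excluded because its z₄ has norm at least `R`.
    · rw [hz, hw] at hR
      exact absurd (hR 3) (not_lt.2 hconj)
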